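/- Let $n\ge 0$ be an integer, and let $\mathscr{C}(\mathbb{R}^n)$ be the Chabauty space of $\mathbb{R}^n$, that is, the set of all closed subgroups of $(\mathbb{R}^n,+)$ with the topology in which the sets $$\mathcal{N}_U^K(\Gamma)=\{\Gamma'\in\mathscr{C}(\mathbb{R}^n) : \Gamma'\cap K\subset\Gamma+U \text{ and } \Gamma\cap K\subset\Gamma'+U\},$$ where $K$ runs over the compact subsets of $\mathbb{R}^n$ and $U$ over the neighbourhoods of $0$, form a basis of neighbourhoods of each point $\Gamma$. Then $\mathscr{C}(\mathbb{R}^n)$ is simply connected: it is nonempty and path-connected, and its fundamental group is trivial. -/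

import Mathlib

open scoped Pointwise Topology

/-- The set of closed subgroups of a topological group, written additively (the group need not be
commutative); it carries the topology `instTopologicalSpaceChabautySpace` below. -/
abbrev ChabautySpace (G : Type*) [AddGroup G] [TopologicalSpace G] : Type _ :=
  ClosedAddSubgroup G

namespace ChabautySpace

variable {G : Type*} [AddGroup G] [TopologicalSpace G]

/-- The basic neighbourhood of `Γ` given by `K` and `U`: the closed subgroups `Γ'` with
`Γ' ∩ K ⊆ Γ + U` and `Γ ∩ K ⊆ Γ' + U`. -/
def basicNhd (K U : Set G) (Γ : ChabautySpace G) : Set (ChabautySpace G) :=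
  {Γ' | (Γ' : Set G) ∩ K ⊆ (Γ : Set G) + U ∧ (Γ : Set G) ∩ K ⊆ (Γ' : Set G) + U}

theorem basicNhd_mono {K K' U U' : Set G} (hK : K ⊆ K') (hU : U' ⊆ U) (Γ : ChabautySpace G) :
    basicNhd K' U' Γ ⊆ basicNhd K U Γ := fun _ h =>
  ⟨((Set.inter_subset_inter_right _ hK).trans h.1).trans (Set.add_subset_add_left hU),
    ((Set.inter_subset_inter_right _ hK).trans h.2).trans (Set.add_subset_add_left hU)⟩

/-- The Chabauty topology: a set is open when with each of its points `Γ` it contains a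
`basicNhd K U Γ`, with `K` compact and `U` a neighbourhood of the neutral element. -/
instance instTopologicalSpaceChabautySpace : TopologicalSpace (ChabautySpace G) where
  IsOpen s := ∀ Γ ∈ s, ∃ K U : Set G, IsCompact K ∧ U ∈ 𝓝 (0 : G) ∧ basicNhd K U Γ ⊆ s
  isOpen_univ _ _ := ⟨∅, Set.univ, isCompact_empty, Filter.univ_mem, Set.subset_univ _⟩
  isOpen_inter s t hs ht Γ hΓ := by
    obtain ⟨K, U, hK, hU, h⟩ := hs Γ hΓ.1
    obtain ⟨K', U', hK', hU', h'⟩ := ht Γ hΓ.2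
    exact ⟨K ∪ K', U ∩ U', hK.union hK', Filter.inter_mem hU hU', Set.subset_inter
      ((basicNhd_mono Set.subset_union_left Set.inter_subset_left Γ).trans h)
      ((basicNhd_mono Set.subset_union_right Set.inter_subset_right Γ).trans h')⟩
  isOpen_sUnion S hS Γ := by
    rintro ⟨s, hs, hΓ⟩
    obtain ⟨K, U, hK, hU, h⟩ := hS s hs Γ hΓ
    exact ⟨K, U, hK, hU, h.trans (Set.subset_sUnion_of_mem hs)⟩

theorem isOpen_iff {s : Set (ChabautySpace G)} :
    IsOpen s ↔ ∀ Γ ∈ s, ∃ K U : Set G, IsCompact K ∧ U ∈ 𝓝 (0 : G) ∧ basicNhd K U Γ ⊆ s :=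
  Iff.rfl

theorem self_mem_basicNhd (K : Set G) {U : Set G} (hU : U ∈ 𝓝 (0 : G)) (Γ : ChabautySpace G) :
    Γ ∈ basicNhd K U Γ := by
  have h : (Γ : Set G) ∩ K ⊆ (Γ : Set G) + U := fun x hx =>
    ⟨x, hx.1, 0, mem_of_mem_nhds hU, add_zero x⟩
  exact ⟨h, h⟩

/-- In a locally compact group the sets `basicNhd K U Γ` are a basis of neighbourhoods of `Γ`. -/
theorem hasBasis_nhds [IsTopologicalAddGroup G] [LocallyCompactSpace G] (Γ : ChabautySpace G) :
    (𝓝 Γ).HasBasis (fun p : Set G × Set G => IsCompact p.1 ∧ p.2 ∈ 𝓝 (0 : G))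
      (fun p => basicNhd p.1 p.2 Γ) := by
  refine ⟨fun t => ⟨fun ht => ?_, ?_⟩⟩
  · obtain ⟨s, hst, hs, hΓ⟩ := mem_nhds_iff.1 ht
    obtain ⟨K, U, hK, hU, h⟩ := hs Γ hΓ
    exact ⟨(K, U), ⟨hK, hU⟩, h.trans hst⟩
  · rintro ⟨⟨K, U⟩, ⟨hK, hU⟩, h⟩
    have step : ∀ (K U : Set G), IsCompact K → U ∈ 𝓝 (0 : G) → ∃ K' V : Set G, IsCompact K' ∧
        V ∈ 𝓝 (0 : G) ∧ ∀ Γ₁ Γ₂ Γ₃ : ChabautySpace G, Γ₂ ∈ basicNhd K' V Γ₁ →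
          Γ₃ ∈ basicNhd K' V Γ₂ → Γ₃ ∈ basicNhd K U Γ₁ := by
      intro K U hK hU
      obtain ⟨W, hW, hWU⟩ := exists_nhds_zero_half hU
      obtain ⟨C, hC, hCW, hCc⟩ := local_compact_nhds hW
      have key : ∀ A B D : Set G, A ∩ (K + -C) ⊆ B + C → B ∩ (K + -C) ⊆ D + C →
          A ∩ K ⊆ D + U := by
        rintro A B D hAB hBD x ⟨hxA, hxK⟩
        obtain ⟨b, hb, c, hc, rfl⟩ := hAB
          ⟨hxA, ⟨x, hxK, 0, by simpa using mem_of_mem_nhds hC, add_zero x⟩⟩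
        obtain ⟨d, hd, c', hc', rfl⟩ := hBD
          ⟨hb, ⟨b + c, hxK, -c, by simpa using hc, by simp⟩⟩
        exact ⟨d, hd, c' + c, hWU _ (hCW hc') _ (hCW hc), by simp [add_assoc]⟩
      exact ⟨K + -C, C, hK.add hCc.neg, hC, fun Γ₁ Γ₂ Γ₃ h₁ h₂ =>
        ⟨key _ _ _ h₂.1 h₁.1, key _ _ _ h₁.2 h₂.2⟩⟩
    refine mem_nhds_iff.2 ⟨{Γ' | ∃ K' V : Set G, IsCompact K' ∧ V ∈ 𝓝 (0 : G) ∧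
      basicNhd K' V Γ' ⊆ basicNhd K U Γ}, ?_, ?_, ⟨K, U, hK, hU, subset_rfl⟩⟩
    · rintro Γ' ⟨K', V, -, hV, h'⟩
      exact h (h' (self_mem_basicNhd K' hV Γ'))
    · rintro Γ' ⟨K', V, hK', hV, h'⟩
      obtain ⟨K'', V', hK'', hV', h''⟩ := step K' V hK' hV
      exact ⟨K'', V', hK'', hV', fun Γ₂ hΓ₂ => ⟨K'', V', hK'', hV',
        fun Γ₃ hΓ₃ => h' (h'' Γ' Γ₂ Γ₃ hΓ₂ hΓ₃)⟩⟩

end ChabautySpace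

/-! Let `D` be the set of discrete subgroups of E, a finite-dimensional real vector space.
Multiplying by ever larger scalars pushes the nonzero elements of a discrete subgroup to infinity,
so `D` contracts inside the Chabauty space to the trivial subgroup, and two paths in `D` with the
same endpoints are homotopic. The rest of the space is controlled by two local facts: arbitrarily
small paths lead from any Γ into `D` (`accessibleFrom_discreteSubgroups`), and every Γ has a
neighbourhood N that is homotopically trivial in the whole space and for which N ∩ `D` is path
connected (`locallyTrivialAt_discreteSubgroups`).

These facts suffice (`simplyConnectedSpace_of_locallyTrivial`). Fix d in `D`. A homotopy class of
paths from d to x is approachable if it can be represented inside `D` up to an arbitrarily short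
tail. The local facts make an approachable class unique at each x and carry approachability along
every path; since the constant class at d is approachable, any two paths with the same endpoints are
homotopic.

For accessibility, write Γ as ℝᵖ × Λ with Λ discrete and replace ℝᵖ by sℤᵖ with s → 0. For local
triviality, expansion makes Γ converge to its largest linear subspace and acts by homeomorphisms
preserving `D`, so it is enough to treat a subspace V × 0 of V × W. A subgroup near V × 0 becomes
straight after a unique small shear, which depends continuously on the subgroup, and is then
squeezed onto V × 0. If it is discrete, it is instead flattened to a lattice in V. Bases of lattices
form GL(p, ℝ); its two components give the same lattices, because sign changes preserve ℤᵖ. So N ∩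
`D` is path connected. -/

open scoped unitInterval

/-! ### Homotopical triviality and its local versions -/

/-- Two paths with the same endpoints that run in `N` are homotopic in the ambient space. -/
def HomotopicallyTrivialIn {X : Type*} [TopologicalSpace X] (N : Set X) : Prop :=
  ∀ ⦃x y : X⦄ (p q : Path x y), (∀ t, p t ∈ N) → (∀ t, q t ∈ N) → p.Homotopic q

namespace HomotopicallyTrivialIn

open Path.Homotopic.Quotient in
/-- If the inclusion of `N` is homotopic to a constant map then `N` is homotopically trivial. -/
theorem of_nullhomotopic {X : Type*} [TopologicalSpace X] {N : Set X}
    (h : (⟨Subtype.val, continuous_subtype_val⟩ : C(N, X)).Nullhomotopic) :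
    HomotopicallyTrivialIn N := by
  obtain ⟨c, ⟨F⟩⟩ := h
  intro x y p q hp hq
  have hx : x ∈ N := by simpa using hp 0
  have hy : y ∈ N := by simpa using hp 1
  let lift (r : Path x y) (hr : ∀ t, r t ∈ N) : Path (⟨x, hx⟩ : N) ⟨y, hy⟩ :=
    ⟨⟨fun t => ⟨r t, hr t⟩, by fun_prop⟩, by simp, by simp⟩
  have key (r : Path x y) (hr : ∀ t, r t ∈ N) :
      (mk r).trans (mk (F.evalAt ⟨y, hy⟩)) = (mk (F.evalAt ⟨x, hx⟩)).trans (refl c) := by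
    have := eq.2 (Path.Homotopic.map_trans_evalAt F (lift r hr))
    rw [mk_trans, mk_trans] at this
    convert! this using 1
  have h := (key p hp).trans (key q hq).symm
  have h2 := congrArg (fun z => z.trans (symm (mk (F.evalAt ⟨y, hy⟩)))) h
  rw [← eq]
  simpa [trans_assoc] using h2

theorem preimage {X Y : Type*} [TopologicalSpace X] [TopologicalSpace Y] (φ : X ≃ₜ Y) {N : Set Y}
    (h : HomotopicallyTrivialIn N) : HomotopicallyTrivialIn (φ ⁻¹' N) := by
  intro x y p q hp hq
  have := (h (p.map φ.continuous) (q.map φ.continuous) hp hq).map (φ.symm : C(Y, X))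
  have := this.pathCast (φ.symm_apply_apply x).symm (φ.symm_apply_apply y).symm
  convert! this using 1 <;> ext t <;> simp

end HomotopicallyTrivialIn

/-- `D` is locally accessible at `x`: arbitrarily small paths lead from `x` into `D`. -/
def AccessibleFrom {X : Type*} [TopologicalSpace X] (D : Set X) (x : X) : Prop :=
  ∀ O : Set X, IsOpen O → x ∈ O → ∃ y ∈ D, JoinedIn O x y

/-- The point `x` has a homotopically trivial neighbourhood whose trace on `D` is
path connected. -/
def LocallyTrivialAt {X : Type*} [TopologicalSpace X] (D : Set X) (x : X) : Prop :=
  ∃ N ∈ 𝓝 x, HomotopicallyTrivialIn N ∧ ∀ y ∈ N ∩ D, ∀ z ∈ N ∩ D, JoinedIn (N ∩ D) y z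

section Transport

variable {X Y : Type*} [TopologicalSpace X] [TopologicalSpace Y] {D : Set X} {D' : Set Y}

theorem JoinedIn.preimage_homeomorph (φ : X ≃ₜ Y) {S : Set Y} {x y : X}
    (h : JoinedIn S (φ x) (φ y)) : JoinedIn (φ ⁻¹' S) x y := by
  have := h.map φ.symm.continuous
  simpa [φ.image_symm] using this

theorem AccessibleFrom.of_homeomorph (φ : X ≃ₜ Y) (hD : φ ⁻¹' D' = D) {x : X}
    (h : AccessibleFrom D' (φ x)) : AccessibleFrom D x := by
  intro O hO hx
  obtain ⟨y, hy, hj⟩ := h (φ.symm ⁻¹' O) (hO.preimage φ.symm.continuous) (by simpa using hx)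
  refine ⟨φ.symm y, by rw [← hD]; simpa using hy, ?_⟩
  have := JoinedIn.preimage_homeomorph φ (x := x) (y := φ.symm y) (by simpa using hj)
  simpa [← Set.preimage_comp] using this

theorem LocallyTrivialAt.of_homeomorph (φ : X ≃ₜ Y) (hD : φ ⁻¹' D' = D) {x : X}
    (h : LocallyTrivialAt D' (φ x)) : LocallyTrivialAt D x := by
  obtain ⟨N, hN, ht, hj⟩ := h
  refine ⟨φ ⁻¹' N, φ.continuous.continuousAt hN, ht.preimage φ, fun y hy z hz => ?_⟩
  subst hD
  exact JoinedIn.preimage_homeomorph φ (hj _ hy _ hz)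

end Transport

/-! ### Transfer of simple connectedness from `D` to the whole space -/

section Transfer

open Path.Homotopic.Quotient

variable {X : Type*} [TopologicalSpace X]

/-- The class `α` of paths from `d` to `x` is represented by paths that run in `D` up to an
arbitrarily small last part. -/
def ApproachableIn (D : Set X) {d x : X} (α : Path.Homotopic.Quotient d x) : Prop :=
  ∀ O : Set X, IsOpen O → x ∈ O → ∃ (y : X) (a : Path d y) (c : Path y x),
    (∀ t, a t ∈ D) ∧ (∀ t, c t ∈ O) ∧ α = (mk a).trans (mk c)

theorem Path.trans_mem {S : Set X} {x y z : X} {p : Path x y} {q : Path y z}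
    (hp : ∀ t, p t ∈ S) (hq : ∀ t, q t ∈ S) (t : I) : p.trans q t ∈ S := by
  rw [Path.trans_apply]
  split_ifs
  · exact hp _
  · exact hq _

theorem Path.symm_mem {S : Set X} {x y : X} {p : Path x y} (hp : ∀ t, p t ∈ S) (t : I) :
    p.symm t ∈ S := hp _

namespace ApproachableIn

variable {D : Set X} {d x x' : X}

/-- With both tails c and e inside the neighbourhood N, join their starting points by a path f in N
∩ D. Then c is homotopic to f·e because N is trivial, and a·f to b because D is trivial. -/
theorem unique (htriv : HomotopicallyTrivialIn D) (hloc : LocallyTrivialAt D x)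
    {α β : Path.Homotopic.Quotient d x} (hα : ApproachableIn D α) (hβ : ApproachableIn D β) :
    α = β := by
  obtain ⟨N, hN, hNt, hNj⟩ := hloc
  obtain ⟨O, hON, hO, hxO⟩ := mem_nhds_iff.1 hN
  obtain ⟨y, a, c, ha, hc, rfl⟩ := hα O hO hxO
  obtain ⟨z, b, e, hb, he, rfl⟩ := hβ O hO hxO
  replace hc t := hON (hc t)
  replace he t := hON (he t)
  have hy : y ∈ N ∩ D := ⟨by simpa using hc 0, by simpa using ha 1⟩
  have hz : z ∈ N ∩ D := ⟨by simpa using he 0, by simpa using hb 1⟩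
  obtain ⟨f, hf⟩ := hNj y hy z hz
  have h1 := eq.2 (hNt c (f.trans e) hc (Path.trans_mem (fun t => (hf t).1) he))
  have h2 := eq.2 (htriv (a.trans f) b (Path.trans_mem ha fun t => (hf t).2) hb)
  rw [mk_trans] at h1 h2
  rw [h1, ← h2, trans_assoc]

/-- Extension of approachability along a path short enough to stay in one good neighbourhood N. A
short path e leads from the new endpoint into D; inside N the old tail followed by p is deformed to
a path f in N ∩ D followed by the reverse of e, which is the new tail. -/
theorem trans_of_mem (hacc : AccessibleFrom D x') {N : Set X} (hNt : HomotopicallyTrivialIn N)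
    (hNj : ∀ y ∈ N ∩ D, ∀ z ∈ N ∩ D, JoinedIn (N ∩ D) y z)
    {α : Path.Homotopic.Quotient d x} (hα : ApproachableIn D α) (p : Path x x')
    (hp : ∀ t, p t ∈ interior N) : ApproachableIn D (α.trans (mk p)) := by
  intro O hO hx'
  obtain ⟨z, hz, e, he⟩ := hacc (O ∩ interior N) (hO.inter isOpen_interior)
    ⟨hx', by simpa using hp 1⟩
  obtain ⟨y, a, c, ha, hc, rfl⟩ := hα (interior N) isOpen_interior (by simpa using hp 0)
  replace hc t := interior_subset (hc t)
  have hp' t := interior_subset (hp t)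
  have he' t := interior_subset (he t).2
  obtain ⟨f, hf⟩ := hNj y ⟨by simpa using hc 0, by simpa using ha 1⟩ z
    ⟨by simpa using he' 1, hz⟩
  refine ⟨z, a.trans f, e.symm, Path.trans_mem ha fun t => (hf t).2,
    Path.symm_mem fun t => (he t).1, ?_⟩
  have h := eq.2 (hNt (c.trans p) (f.trans e.symm) (Path.trans_mem hc hp')
    (Path.trans_mem (fun t => (hf t).1) (Path.symm_mem he')))
  rw [mk_trans, mk_trans] at h
  rw [trans_assoc, h, mk_trans, trans_assoc]

theorem cast {α : Path.Homotopic.Quotient d x} (hα : ApproachableIn D α) (h : x' = x) :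
    ApproachableIn D (α.cast rfl h) := by
  subst h
  simpa using hα

theorem trans (hacc : ∀ x, AccessibleFrom D x) (hloc : ∀ x, LocallyTrivialAt D x)
    {α : Path.Homotopic.Quotient d x} (hα : ApproachableIn D α) (p : Path x x') :
    ApproachableIn D (α.trans (mk p)) := by
  choose N hN hNt hNj using hloc
  -- A Lebesgue subdivision cuts p into pieces, each inside the interior of one good neighbourhood.
  obtain ⟨t, ht0, htm, ⟨m, hm⟩, hts⟩ := exists_monotone_Icc_subset_open_cover_unitInterval
    (c := fun y : X => p ⁻¹' interior (N y)) (fun y => isOpen_interior.preimage p.continuous)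
    (fun s _ => Set.mem_iUnion.2 ⟨p s, mem_interior_iff_mem_nhds.2 (hN _)⟩)
  have hind (n : ℕ) : ApproachableIn D
      ((α.cast rfl p.source).trans (mk (p.subpath 0 (t n)))) := by
    induction n with
    | zero =>
      rw [ht0, Path.subpath_self, mk_refl, trans_refl]
      exact hα.cast _
    | succ n ih =>
      obtain ⟨y, hy⟩ := hts n
      have := ih.trans_of_mem (hacc _) (hNt y) (hNj y) (p.subpath (t n) (t (n + 1))) (fun s => by
        have : p.subpath (t n) (t (n + 1)) s ∈ Set.range (p.subpath (t n) (t (n + 1))) := ⟨s, rfl⟩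
        rw [Path.range_subpath_of_le _ _ _ (htm n.le_succ)] at this
        obtain ⟨u, hu, hus⟩ := this
        rw [← hus]
        exact hy hu)
      rw [trans_assoc, ← mk_trans, eq.2 ⟨Path.Homotopy.subpathTransSubpath p 0 _ _⟩] at this
      exact this
  have h1 := hind m
  rw [hm m le_rfl, Path.subpath_zero_one, mk_cast] at h1
  have h2 := h1.cast p.target.symm
  convert h2 using 1
  have (u v : X) (hu : u = x) (hv : v = x') :
      ((α.cast rfl hu).trans ((mk p).cast hu hv)).cast rfl hv.symm = α.trans (mk p) := by
    subst hu hv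
    simp
  exact (this _ _ p.source p.target).symm

end ApproachableIn

/-- A space is simply connected if it has a subset `D` that is nonempty, path connected,
homotopically trivial and locally accessible, and if each point has a homotopically trivial
neighbourhood whose trace on `D` is path connected. -/
theorem simplyConnectedSpace_of_locallyTrivial {D : Set X} (hD : D.Nonempty)
    (htriv : HomotopicallyTrivialIn D) (hjoin : ∀ x ∈ D, ∀ y ∈ D, Joined x y)
    (hacc : ∀ x, AccessibleFrom D x) (hloc : ∀ x, LocallyTrivialAt D x) :
    SimplyConnectedSpace X := by
  obtain ⟨d, hd⟩ := hD
  have hj (x : X) : Joined d x := by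
    obtain ⟨y, hy, h⟩ := hacc x Set.univ isOpen_univ trivial
    exact (hjoin d hd y hy).trans h.joined.symm
  have hpc : PathConnectedSpace X := ⟨⟨d⟩, fun x y => (hj x).symm.trans (hj y)⟩
  refine simply_connected_iff_paths_homotopic'.2 ⟨hpc, fun {x y} p q => ?_⟩
  have h0 : ApproachableIn D (refl d) := fun O _ hdO =>
    ⟨d, Path.refl d, Path.refl d, fun _ => hd, fun _ => hdO, by simp⟩
  have h1 := h0.trans hacc hloc (hj x).somePath
  have h2 := (h1.trans hacc hloc p).unique htriv (hloc y) (h1.trans hacc hloc q)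
  -- Uniqueness at y gives σ·p = σ·q for the fixed path σ from d to x; cancel σ.
  have h3 := congrArg (fun z => (symm ((refl d).trans (mk (hj x).somePath))).trans z) h2
  rw [← eq]
  simpa only [← trans_assoc, symm_trans, refl_trans] using h3

end Transfer

/-! ### Convergence in the Chabauty topology -/

namespace ChabautySpace

open Filter Metric

section Convergence

variable {E : Type*} [NormedAddCommGroup E]

theorem isClosed_coe (Γ : ChabautySpace E) : IsClosed (Γ : Set E) := Γ.isClosed'

theorem isOpen_setOf_hits {O : Set E} (hO : IsOpen O) :
    IsOpen {Γ : ChabautySpace E | ∃ v ∈ O, v ∈ Γ} := by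
  rintro Γ ⟨v, hvO, hv⟩
  refine ⟨{v}, {u | v - u ∈ O}, isCompact_singleton,
    (continuous_const.sub continuous_id).continuousAt.preimage_mem_nhds
      (hO.mem_nhds (by simpa using hvO)), fun Γ' h => ?_⟩
  obtain ⟨g, hg, u, hu, hgu⟩ := h.2 ⟨hv, rfl⟩
  refine ⟨g, ?_, hg⟩
  have : v - u ∈ O := hu
  rwa [← hgu, add_sub_cancel_right] at this

theorem isOpen_setOf_misses {K : Set E} (hK : IsCompact K) :
    IsOpen {Γ : ChabautySpace E | ∀ v ∈ K, v ∉ Γ} := by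
  intro Γ hΓ
  obtain ⟨δ, hδ, hd⟩ := (Set.disjoint_left.2 hΓ : Disjoint K (Γ : Set E)).exists_thickenings
    hK Γ.isClosed_coe
  refine ⟨K, ball 0 δ, hK, ball_mem_nhds _ hδ, fun Γ' h v hv hvΓ => ?_⟩
  refine Set.disjoint_left.1 hd (self_subset_thickening hδ _ hv) ?_
  rw [← add_ball_zero]
  exact h.1 ⟨hvΓ, hv⟩

variable [ProperSpace E]

/-- The working form of Chabauty convergence: every element of Γ is a limit of elements of the `f
i`, and such elements do not accumulate outside Γ. Conversely, compactness of Γ ∩ K and of K minus a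
thickening of Γ makes these pointwise conditions uniform on K. -/
theorem tendsto_nhds_iff {ι : Type*} {l : Filter ι} {f : ι → ChabautySpace E}
    {Γ : ChabautySpace E} :
    Tendsto f l (𝓝 Γ) ↔ (∀ v ∈ Γ, ∀ O ∈ 𝓝 v, ∀ᶠ i in l, ∃ u ∈ O, u ∈ f i) ∧
      ∀ w ∉ Γ, ∀ᶠ p : ι × E in l ×ˢ 𝓝 w, p.2 ∉ f p.1 := by
  constructor
  · refine fun h => ⟨fun v hv O hO => ?_, fun w hw => ?_⟩
    · obtain ⟨O', hO'O, hO', hvO'⟩ := _root_.mem_nhds_iff.1 hO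
      filter_upwards [h.eventually ((isOpen_setOf_hits hO').mem_nhds ⟨v, hvO', hv⟩)]
      rintro i ⟨u, hu, hui⟩
      exact ⟨u, hO'O hu, hui⟩
    · obtain ⟨K, hKw, hKΓ, hK⟩ := local_compact_nhds (Γ.isClosed_coe.isOpen_compl.mem_nhds hw)
      have h1 := h.eventually ((isOpen_setOf_misses hK).mem_nhds fun v hv => hKΓ hv)
      filter_upwards [h1.prod_mk (show ∀ᶠ u in 𝓝 w, u ∈ K from hKw)] with p hp
      exact hp.1 _ hp.2
  · rintro ⟨h1, h2⟩
    rw [(hasBasis_nhds Γ).tendsto_right_iff]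
    rintro ⟨K, U⟩ ⟨hK, hU⟩
    obtain ⟨ε, hε, hεU⟩ := Metric.mem_nhds_iff.1 hU
    refine Eventually.and ?_ ?_
    · have hK' : IsCompact (K \ thickening ε (Γ : Set E)) := hK.diff isOpen_thickening
      have : ∀ᶠ i in l, ∀ v ∈ K \ thickening ε (Γ : Set E), v ∉ f i := by
        refine hK'.induction_on (p := fun s => ∀ᶠ i in l, ∀ v ∈ s, v ∉ f i) (by simp)
          (fun s t hst ht => ht.mono fun i hi v hv => hi v (hst hv))
          (fun s t hs ht => by
            filter_upwards [hs, ht] with i hi hi' v hv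
            exact hv.elim (hi v) (hi' v)) fun w hw => ?_
        have hwΓ : w ∉ Γ := fun h => hw.2 (self_subset_thickening hε _ h)
        obtain ⟨pa, hpa, pb, hpb, h⟩ := eventually_prod_iff.1 (h2 w hwΓ)
        exact ⟨{u | pb u}, mem_nhdsWithin_of_mem_nhds hpb,
          hpa.mono fun i hi v hv => h hi hv⟩
      filter_upwards [this] with i hi v hv
      by_contra hvU
      refine hi v ⟨hv.2, fun hvt => hvU ?_⟩ hv.1
      rw [← add_ball_zero] at hvt
      exact Set.add_subset_add_left hεU hvt
    · have hK' : IsCompact ((Γ : Set E) ∩ K) := hK.inter_left Γ.isClosed_coe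
      refine hK'.induction_on (p := fun s => ∀ᶠ i in l, s ⊆ (f i : Set E) + U) (by simp)
          (fun s t hst ht => ht.mono fun i hi => hst.trans hi)
          (fun s t hs ht => by
            filter_upwards [hs, ht] with i hi hi'
            exact Set.union_subset hi hi') fun v hv => ?_
      refine ⟨ball v (ε / 2), mem_nhdsWithin_of_mem_nhds (ball_mem_nhds _ (half_pos hε)), ?_⟩
      filter_upwards [h1 v hv.1 _ (ball_mem_nhds _ (half_pos hε))]
      rintro i ⟨u, hu, hui⟩ w hw
      refine ⟨u, hui, w - u, hεU ?_, by simp⟩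
      rw [mem_ball_zero_iff, ← dist_eq_norm]
      rw [mem_ball] at hu hw
      have := dist_triangle_right w u v
      linarith

theorem continuousAt_iff {Y : Type*} [TopologicalSpace Y] {f : Y → ChabautySpace E} {y : Y} :
    ContinuousAt f y ↔ (∀ v ∈ f y, ∀ O ∈ 𝓝 v, ∀ᶠ i in 𝓝 y, ∃ u ∈ O, u ∈ f i) ∧
      ∀ w ∉ f y, ∀ᶠ p : Y × E in 𝓝 (y, w), p.2 ∉ f p.1 := by
  rw [ContinuousAt, tendsto_nhds_iff]
  simp only [nhds_prod_eq]

end Convergence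

/-! ### Preimages under linear maps -/

section Linear

variable {E F H : Type*} [NormedAddCommGroup E] [NormedSpace ℝ E] [NormedAddCommGroup F]
  [NormedSpace ℝ F] [NormedAddCommGroup H] [NormedSpace ℝ H]

/-- The preimage of a closed subgroup under a continuous linear map. -/
def comap (A : E →L[ℝ] F) (Γ : ChabautySpace F) : ChabautySpace E where
  toAddSubgroup := Γ.toAddSubgroup.comap (A : E →+ F)
  isClosed' := Γ.isClosed'.preimage A.continuous

@[simp]
theorem mem_comap {A : E →L[ℝ] F} {Γ : ChabautySpace F} {v : E} : v ∈ comap A Γ ↔ A v ∈ Γ :=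
  Iff.rfl

theorem comap_comap (A : E →L[ℝ] F) (B : F →L[ℝ] H) (Γ : ChabautySpace H) :
    comap A (comap B Γ) = comap (B ∘L A) Γ := rfl

@[simp]
theorem comap_id (Γ : ChabautySpace E) : comap (.id ℝ E) Γ = Γ := rfl

/-- The trivial subgroup, as a point of the Chabauty space. -/
def trivialSubgroup (E : Type*) [NormedAddCommGroup E] : ChabautySpace E where
  toAddSubgroup := ⊥
  isClosed' := isClosed_singleton

@[simp]
theorem mem_trivialSubgroup {E : Type*} [NormedAddCommGroup E] {v : E} :
    v ∈ trivialSubgroup E ↔ v = 0 := Iff.rfl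

variable [ProperSpace E] [ProperSpace F]

/-- Elements of the nearby preimages are produced by applying B to elements of the nearby subgroups,
so B must be a right inverse near y but a left inverse only at y. Norm continuity makes evaluation
jointly continuous. -/
theorem continuousAt_comap {Y : Type*} [TopologicalSpace Y] {f : Y → ChabautySpace F} {y : Y}
    {A : Y → E →L[ℝ] F} {B : Y → F →L[ℝ] E} (hf : ContinuousAt f y) (hA : ContinuousAt A y)
    (hB : ContinuousAt B y) (hAB : ∀ᶠ i in 𝓝 y, ∀ u, A i (B i u) = u)
    (hBA : ∀ v, B y (A y v) = v) :
    ContinuousAt (fun i => comap (A i) (f i)) y := by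
  rw [continuousAt_iff] at hf ⊢
  refine ⟨fun v hv O hO => ?_, fun w hw => ?_⟩
  · have hcont : Tendsto (fun p : Y × F => B p.1 p.2) (𝓝 y ×ˢ 𝓝 (A y v)) (𝓝 v) := by
      have : ContinuousAt (fun p : Y × F => B p.1 p.2) (y, A y v) :=
        (hB.comp (x := (y, A y v)) continuousAt_fst).clm_apply continuousAt_snd
      rw [ContinuousAt, nhds_prod_eq, hBA] at this
      exact this
    obtain ⟨pa, hpa, pb, hpb, h⟩ := eventually_prod_iff.1 (hcont hO)
    filter_upwards [hpa, hAB, hf.1 _ hv {u | pb u} hpb]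
    rintro i hi hABi ⟨u, hu, hui⟩
    exact ⟨B i u, h hi hu, by rw [mem_comap, hABi]; exact hui⟩
  · have hcont : ContinuousAt (fun p : Y × E => (p.1, A p.1 p.2)) (y, w) :=
      continuousAt_fst.prodMk
        ((hA.comp (x := (y, w)) continuousAt_fst).clm_apply continuousAt_snd)
    exact hcont.eventually (hf.2 _ hw)

theorem continuous_comap {Y : Type*} [TopologicalSpace Y] {f : Y → ChabautySpace F}
    {A : Y → E →L[ℝ] F} {B : Y → F →L[ℝ] E} (hf : Continuous f) (hA : Continuous A)
    (hB : Continuous B) (hAB : ∀ i u, A i (B i u) = u) (hBA : ∀ i v, B i (A i v) = v) :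
    Continuous (fun i => comap (A i) (f i)) :=
  continuous_iff_continuousAt.2 fun _ => continuousAt_comap hf.continuousAt hA.continuousAt
    hB.continuousAt (.of_forall hAB) (hBA _)

/-- The homeomorphism of Chabauty spaces induced by a linear isomorphism. -/
def congr (e : E ≃L[ℝ] F) : ChabautySpace E ≃ₜ ChabautySpace F where
  toFun := comap (e.symm : F →L[ℝ] E)
  invFun := comap (e : E →L[ℝ] F)
  left_inv Γ := SetLike.ext fun v => by simp
  right_inv Γ := SetLike.ext fun v => by simp
  continuous_toFun := continuous_comap continuous_id (A := fun _ => (e.symm : F →L[ℝ] E))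
    (B := fun _ => (e : E →L[ℝ] F)) continuous_const continuous_const (by simp) (by simp)
  continuous_invFun := continuous_comap continuous_id (A := fun _ => (e : E →L[ℝ] F))
    (B := fun _ => (e.symm : F →L[ℝ] E)) continuous_const continuous_const (by simp) (by simp)

@[simp]
theorem mem_congr {e : E ≃L[ℝ] F} {Γ : ChabautySpace E} {v : F} :
    v ∈ congr e Γ ↔ e.symm v ∈ Γ := Iff.rfl

end Linear

/-! ### Discrete subgroups and their contraction by expansion -/

section Discrete

variable {E F : Type*} [NormedAddCommGroup E] [NormedSpace ℝ E] [NormedAddCommGroup F]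
  [NormedSpace ℝ F]

/-- The discrete subgroups. -/
def discreteSubgroups (E : Type*) [NormedAddCommGroup E] : Set (ChabautySpace E) :=
  {Γ | ∃ r > 0, ∀ v ∈ Γ, ‖v‖ < r → v = 0}

theorem comap_mem_discreteSubgroups {A : E →L[ℝ] F} (hA : Function.Injective A)
    {Γ : ChabautySpace F} (hΓ : Γ ∈ discreteSubgroups F) : comap A Γ ∈ discreteSubgroups E := by
  obtain ⟨r, hr, h⟩ := hΓ
  have : ∀ᶠ v in 𝓝 (0 : E), A v ∈ ball 0 r :=
    A.continuous.continuousAt (by simpa using ball_mem_nhds (0 : F) hr)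
  obtain ⟨s, hs, hsr⟩ := Metric.mem_nhds_iff.1 this
  refine ⟨s, hs, fun v hv hvs => hA ?_⟩
  rw [map_zero]
  exact h _ hv (by simpa using hsr (mem_ball_zero_iff.2 hvs))

theorem preimage_congr_discreteSubgroups [ProperSpace E] [ProperSpace F] (e : E ≃L[ℝ] F) :
    congr e ⁻¹' discreteSubgroups F = discreteSubgroups E := by
  ext Γ
  refine ⟨fun h => ?_, fun h => comap_mem_discreteSubgroups e.symm.injective h⟩
  have := comap_mem_discreteSubgroups (A := (e : E →L[ℝ] F)) e.injective h
  convert this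
  exact SetLike.ext fun v => by simp

/-- The last multiple of v before leaving the ball of radius r. It turns a statement about all small
vectors of a subgroup into one about a compact shell. -/
theorem exists_nat_mul_norm_mem_Icc {v : E} {r : ℝ} (hv : v ≠ 0) (hr : ‖v‖ ≤ r) :
    ∃ k : ℕ, ‖k • v‖ ∈ Set.Icc (r / 2) r := by
  have h0 : 0 < ‖v‖ := norm_pos_iff.2 hv
  refine ⟨⌊r / ‖v‖⌋₊, ?_⟩
  rw [← Nat.cast_smul_eq_nsmul ℝ, norm_smul, Real.norm_natCast]
  have h1 := Nat.floor_le (div_nonneg (h0.le.trans hr) h0.le)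
  have h2 := Nat.lt_floor_add_one (r / ‖v‖)
  have h3 : (1 : ℝ) ≤ ⌊r / ‖v‖⌋₊ := by
    exact_mod_cast Nat.le_floor (by rw [Nat.cast_one, one_le_div h0]; exact hr)
  rw [le_div_iff₀ h0] at h1
  rw [div_lt_iff₀ h0] at h2
  constructor
  · nlinarith
  · exact h1

/-- Expansion of a closed subgroup, by the factor `t⁻¹`; at `t = 0` the trivial subgroup. -/
noncomputable def expand (t : ℝ) (Γ : ChabautySpace E) : ChabautySpace E :=
  if t = 0 then trivialSubgroup E else comap (t • .id ℝ E) Γ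

theorem expand_zero (Γ : ChabautySpace E) : expand 0 Γ = trivialSubgroup E := if_pos rfl

theorem expand_one (Γ : ChabautySpace E) : expand 1 Γ = Γ := by
  rw [expand, if_neg one_ne_zero, one_smul, comap_id]

variable [ProperSpace E]

/-- Missing the compact shell between radii r/4 and r/2 is an open condition, and a short nonzero
vector would have a multiple in that shell. So one radius of discreteness serves all subgroups near
Γ. -/
theorem eventually_forall_norm_lt {Γ : ChabautySpace E} (hΓ : Γ ∈ discreteSubgroups E) :
    ∃ r > 0, ∀ᶠ Γ' in 𝓝 Γ, ∀ v ∈ Γ', ‖v‖ < r → v = 0 := by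
  obtain ⟨r, hr, h⟩ := hΓ
  have hK : IsCompact (closedBall (0 : E) (r / 2) \ ball 0 (r / 4)) :=
    (isCompact_closedBall _ _).diff isOpen_ball
  refine ⟨r / 2, half_pos hr, ?_⟩
  filter_upwards [(isOpen_setOf_misses hK).mem_nhds (fun v hv hvΓ => hv.2 (by
    rw [h v hvΓ (by have := mem_closedBall_zero_iff.1 hv.1; linarith)]
    exact mem_ball_self (by linarith)))] with Γ' hΓ' v hv hvr
  by_contra hv0
  obtain ⟨k, hk1, hk2⟩ := exists_nat_mul_norm_mem_Icc hv0 hvr.le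
  refine hΓ' (k • v) ⟨by simpa using hk2, ?_⟩ (nsmul_mem hv k)
  rw [mem_ball_zero_iff, not_lt]
  linarith

/-- At t = 0 the uniform radius r is decisive: near a nonzero w the vectors t • w have norm below r,
so they cannot be nonzero elements of nearby subgroups. -/
theorem continuousAt_expand {p : ℝ × ChabautySpace E} (hp : p.2 ∈ discreteSubgroups E) :
    ContinuousAt (fun p : ℝ × ChabautySpace E => expand p.1 p.2) p := by
  obtain ⟨t, Γ⟩ := p
  rcases eq_or_ne t 0 with rfl | ht
  · rw [continuousAt_iff]
    constructor
    · intro v hv O hO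
      have hv : v = 0 := by simpa [expand] using hv
      subst hv
      exact .of_forall fun i => ⟨0, mem_of_mem_nhds hO, zero_mem _⟩
    · intro w hw
      have hw : w ≠ 0 := by simpa [expand] using hw
      obtain ⟨r, hr, h⟩ := eventually_forall_norm_lt hp
      have h1 : ∀ᶠ q : (ℝ × ChabautySpace E) × E in 𝓝 ((0, Γ), w),
          ∀ v ∈ q.1.2, ‖v‖ < r → v = 0 :=
        (show ContinuousAt (fun q : (ℝ × ChabautySpace E) × E => q.1.2) ((0, Γ), w) by
          fun_prop).eventually h
      have h2 : ∀ᶠ q : (ℝ × ChabautySpace E) × E in 𝓝 ((0, Γ), w), ‖q.1.1 • q.2‖ < r := by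
        have : ContinuousAt (fun q : (ℝ × ChabautySpace E) × E => ‖q.1.1 • q.2‖) ((0, Γ), w) := by
          fun_prop
        exact this.eventually (by simpa using eventually_lt_nhds hr)
      have h3 : ∀ᶠ q : (ℝ × ChabautySpace E) × E in 𝓝 ((0, Γ), w), q.2 ≠ 0 :=
        continuousAt_snd.eventually (eventually_ne_nhds hw)
      filter_upwards [h1, h2, h3] with q hq1 hq2 hq3 hq
      rw [expand] at hq
      split_ifs at hq with hq0
      · exact hq3 hq
      · exact (smul_ne_zero hq0 hq3) (hq1 _ hq hq2)
  · have h1 : ContinuousAt (fun p : ℝ × ChabautySpace E => comap (p.1 • .id ℝ E) p.2) (t, Γ) := by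
      refine continuousAt_comap (B := fun p => p.1⁻¹ • .id ℝ E) continuousAt_snd (by fun_prop)
        ?_ ?_ ?_
      · exact (continuousAt_fst.inv₀ ht).smul continuousAt_const
      · filter_upwards [continuousAt_fst.eventually (eventually_ne_nhds ht)] with i hi u
        simp [smul_smul, inv_mul_cancel₀ hi]
      · intro v
        simp [smul_smul, mul_inv_cancel₀ ht]
    refine h1.congr ?_
    filter_upwards [continuousAt_fst.eventually (eventually_ne_nhds ht)] with i hi
    simp [expand, hi]

theorem homotopicallyTrivialIn_discreteSubgroups :
    HomotopicallyTrivialIn (discreteSubgroups E) := by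
  refine .of_nullhomotopic ⟨trivialSubgroup E, ⟨ContinuousMap.Homotopy.symm
    ⟨⟨fun p => expand (p.1 : ℝ) (p.2 : ChabautySpace E), ?_⟩, ?_, ?_⟩⟩⟩
  · exact continuous_iff_continuousAt.2 fun p =>
      (continuousAt_expand p.2.2).comp (f := fun p : I × discreteSubgroups E =>
        ((p.1 : ℝ), (p.2 : ChabautySpace E))) (by fun_prop)
  · simp [expand_zero]
  · simp [expand_one]

theorem joined_trivialSubgroup {Γ : ChabautySpace E} (hΓ : Γ ∈ discreteSubgroups E) :
    Joined Γ (trivialSubgroup E) := by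
  refine Joined.symm ⟨⟨⟨fun t : I => expand (t : ℝ) Γ, ?_⟩, by simp [expand_zero],
    by simp [expand_one]⟩⟩
  exact continuous_iff_continuousAt.2 fun t =>
      (continuousAt_expand hΓ).comp (f := fun t : I => ((t : ℝ), Γ)) (by fun_prop)

end Discrete

end ChabautySpace

/-! ### Subgroups near V × 0: straightening and squeezing -/

namespace ChabautySpace

open Filter Metric

section NearAxis

variable {V W : Type*} [NormedAddCommGroup V] [NormedSpace ℝ V] [NormedAddCommGroup W]
  [NormedSpace ℝ W]

/-- The linear subspace `V × 0` of `V × W`. -/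
noncomputable def axis (V W : Type*) [NormedAddCommGroup V] [NormedSpace ℝ V] [NormedAddCommGroup W]
    [NormedSpace ℝ W] : ChabautySpace (V × W) :=
  comap (.snd ℝ V W) (trivialSubgroup W)

@[simp]
theorem mem_axis {v : V × W} : v ∈ axis V W ↔ v.2 = 0 := Iff.rfl

/-- The closed subgroups of `V × W` whose elements close to `V × 0` lie in `V × 0` and are
`1`-dense there. -/
def straightSubgroups (V W : Type*) [NormedAddCommGroup V] [NormedSpace ℝ V]
    [NormedAddCommGroup W] [NormedSpace ℝ W] : Set (ChabautySpace (V × W)) :=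
  {Γ | (∀ v ∈ Γ, ‖v.2‖ < 1 → v.2 = 0) ∧ ∀ x : V, ∃ x' : V, ‖x' - x‖ ≤ 1 ∧ (x', (0 : W)) ∈ Γ}

/-- The shear of `V × W` given by a linear map from `V` to `W`. -/
noncomputable def shear (τ : V →L[ℝ] W) : V × W →L[ℝ] V × W :=
  .id ℝ (V × W) + (ContinuousLinearMap.inr ℝ V W).comp (τ.comp (.fst ℝ V W))

@[simp]
theorem shear_apply (τ : V →L[ℝ] W) (v : V × W) : shear τ v = (v.1, v.2 + τ v.1) := by
  ext <;> simp [shear]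

theorem shear_zero : shear (0 : V →L[ℝ] W) = .id ℝ (V × W) := by
  ext v <;> simp

theorem shear_comp (τ ρ : V →L[ℝ] W) : shear τ ∘L shear ρ = shear (τ + ρ) := by
  refine ContinuousLinearMap.ext fun v => ?_
  simp only [ContinuousLinearMap.comp_apply, shear_apply, add_apply]
  rw [add_assoc, add_comm (ρ v.1)]

theorem continuous_shear : Continuous (shear : (V →L[ℝ] W) → V × W →L[ℝ] V × W) := by
  unfold shear
  fun_prop

/-- The closed subgroups of `V × W` that become straight under a small shear. -/
def nearAxis (V W : Type*) [NormedAddCommGroup V] [NormedSpace ℝ V] [NormedAddCommGroup W]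
    [NormedSpace ℝ W] : Set (ChabautySpace (V × W)) :=
  {Γ | ∃ τ : V →L[ℝ] W, ‖τ‖ ≤ 1 / 8 ∧ comap (shear τ) Γ ∈ straightSubgroups V W}

theorem straightSubgroups_subset_nearAxis : straightSubgroups V W ⊆ nearAxis V W :=
  fun Γ hΓ => ⟨0, by simp, by rwa [shear_zero, comap_id]⟩

/-- If ρ = τ - τ' were nonzero, a vector with ρ-image of norm 1/2 could be moved by at most 1 to
some x with (x, ρ x) in the second straightened subgroup. Since ‖ρ‖ ≤ 1/4, ρ x has norm at most 3/4
< 1, so it vanishes by straightness; but it differs from a vector of norm 1/2 by at most 1/4. -/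
theorem eq_of_comap_shear_mem {Γ : ChabautySpace (V × W)} {τ τ' : V →L[ℝ] W}
    (hτ : ‖τ‖ ≤ 1 / 8) (hτ' : ‖τ'‖ ≤ 1 / 8) (h : comap (shear τ) Γ ∈ straightSubgroups V W)
    (h' : comap (shear τ') Γ ∈ straightSubgroups V W) : τ = τ' := by
  rw [← sub_eq_zero]
  set ρ := τ - τ' with hρ
  have hρn : ‖ρ‖ ≤ 1 / 4 := (norm_sub_le _ _).trans (by linarith)
  ext u
  rw [zero_apply]
  by_contra hu
  have hu0 : 0 < ‖ρ u‖ := norm_pos_iff.2 hu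
  set c : ℝ := 1 / 2 / ‖ρ u‖ with hc
  have hcu : ‖ρ (c • u)‖ = 1 / 2 := by
    rw [map_smul, norm_smul, Real.norm_of_nonneg (by positivity), hc]
    field_simp
  obtain ⟨x, hx, hxΓ⟩ := h.2 (c • u)
  have h1 : ‖ρ x - ρ (c • u)‖ ≤ 1 / 4 := by
    rw [← map_sub]
    exact (ρ.le_opNorm _).trans (by nlinarith [norm_nonneg ρ, norm_nonneg (x - c • u)])
  have h2 : (x, ρ x) ∈ comap (shear τ') Γ := by
    simpa [hρ] using hxΓ
  have h3 : ρ x = 0 := by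
    refine h'.1 _ h2 ?_
    have := norm_le_norm_add_norm_sub' (ρ x) (ρ (c • u))
    change ‖ρ x‖ < 1
    linarith
  rw [h3, zero_sub, norm_neg] at h1
  linarith

/-- The linear map of `V × W` that is the scalar `a` on `V` and the scalar `b` on `W`. -/
noncomputable def stretch (a b : ℝ) : V × W →L[ℝ] V × W :=
  (a • .id ℝ V : V →L[ℝ] V).prodMap (b • .id ℝ W : W →L[ℝ] W)

@[simp]
theorem stretch_apply (a b : ℝ) (v : V × W) : stretch a b v = (a • v.1, b • v.2) := rfl

theorem stretch_injective {a b : ℝ} (ha : a ≠ 0) (hb : b ≠ 0) :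
    Function.Injective (stretch a b : V × W →L[ℝ] V × W) := by
  intro v w h
  simp only [stretch_apply, Prod.mk.injEq, smul_right_inj ha, smul_right_inj hb] at h
  exact Prod.ext h.1 h.2

theorem continuous_stretch :
    Continuous fun p : ℝ × ℝ => (stretch p.1 p.2 : V × W →L[ℝ] V × W) := by
  have h := (ContinuousLinearMap.prodMapL ℝ V V W W).continuous
  exact h.comp (f := fun p : ℝ × ℝ =>
    (p.1 • ContinuousLinearMap.id ℝ V, p.2 • ContinuousLinearMap.id ℝ W)) (by fun_prop)

/-- The subgroup `Γ` contracted by the factor `t` along `V` and expanded by `t⁻¹` along `W`;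
at `t = 0` the subgroup `V × 0`. -/
noncomputable def squeeze (t : ℝ) (Γ : ChabautySpace (V × W)) : ChabautySpace (V × W) :=
  if t = 0 then axis V W
  else comap (stretch t⁻¹ t) Γ

theorem squeeze_zero (Γ : ChabautySpace (V × W)) : squeeze 0 Γ = axis V W := if_pos rfl

theorem squeeze_one (Γ : ChabautySpace (V × W)) : squeeze 1 Γ = Γ := by
  rw [squeeze, if_neg one_ne_zero]
  exact SetLike.ext fun v => by simp

variable [FiniteDimensional ℝ V]

/-- Straightness means missing the open set 0 < ‖v.2‖ < 1 and hitting the compact sets given by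
closed unit balls in V × 0. Both are closed conditions, which is why one inequality is strict and
the other is not. -/
theorem isClosed_straightSubgroups : IsClosed (straightSubgroups V W) := by
  have h1 : IsOpen {Γ : ChabautySpace (V × W) | ∃ v ∈ {v : V × W | ‖v.2‖ < 1 ∧ v.2 ≠ 0}, v ∈ Γ} :=
    isOpen_setOf_hits (IsOpen.inter (isOpen_lt (f := fun v : V × W => ‖v.2‖) (by fun_prop)
      continuous_const) (isOpen_ne_fun continuous_snd continuous_const))
  have h2 (x : V) : IsOpen {Γ : ChabautySpace (V × W) |
      ∀ v ∈ closedBall x 1 ×ˢ ({0} : Set W), v ∉ Γ} :=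
    isOpen_setOf_misses ((isCompact_closedBall _ _).prod isCompact_singleton)
  convert! h1.isClosed_compl.inter (isClosed_iInter fun x => (h2 x).isClosed_compl) using 1
  ext Γ
  simp only [straightSubgroups, Set.mem_ofPred_eq, Set.mem_inter_iff, Set.mem_compl_iff,
    Set.mem_iInter, Set.mem_prod, mem_closedBall, dist_eq_norm, Set.mem_singleton_iff]
  refine and_congr (by grind) (forall_congr' fun x => ?_)
  push Not
  exact ⟨fun ⟨x', h, h'⟩ => ⟨(x', 0), ⟨h, rfl⟩, h'⟩, fun ⟨v, ⟨h, h0⟩, h'⟩ => ⟨v.1, h, h0 ▸ h'⟩⟩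

variable [FiniteDimensional ℝ W]

theorem continuousAt_comap_stretch {Y : Type*} [TopologicalSpace Y]
    {f : Y → ChabautySpace (V × W)} {a b : Y → ℝ} {y : Y} (hf : ContinuousAt f y)
    (ha : ContinuousAt a y) (hb : ContinuousAt b y) (ha0 : a y ≠ 0) (hb0 : b y ≠ 0) :
    ContinuousAt (fun y => comap (stretch (a y) (b y)) (f y)) y := by
  refine continuousAt_comap (B := fun y => stretch (a y)⁻¹ (b y)⁻¹) hf
    (continuous_stretch.continuousAt.comp (f := fun y => (a y, b y)) (ha.prodMk hb))
    (continuous_stretch.continuousAt.comp (f := fun y => ((a y)⁻¹, (b y)⁻¹))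
      ((ha.inv₀ ha0).prodMk (hb.inv₀ hb0))) ?_ fun v => ?_
  · filter_upwards [ha.eventually_ne ha0, hb.eventually_ne hb0] with z h1 h2 u
    simp [h1, h2]
  · simp [ha0, hb0]

theorem continuous_comap_shear {Y : Type*} [TopologicalSpace Y] {f : Y → ChabautySpace (V × W)}
    {τ : Y → V →L[ℝ] W} (hf : Continuous f) (hτ : Continuous τ) :
    Continuous fun y => comap (shear (τ y)) (f y) :=
  continuous_comap (B := fun y => shear (-τ y)) hf (continuous_shear.comp hτ)
    (continuous_shear.comp hτ.neg) (by simp) (by simp)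

/-- The shear that straightens a subgroup close to the axis depends continuously on it. -/
theorem exists_continuous_straightening :
    ∃ τ : nearAxis V W → V →L[ℝ] W, Continuous τ ∧ ∀ Γ : nearAxis V W,
      ‖τ Γ‖ ≤ 1 / 8 ∧ comap (shear (τ Γ)) (Γ : ChabautySpace (V × W)) ∈ straightSubgroups V W := by
  have hex (Γ : nearAxis V W) := Γ.2
  choose τ hτ using hex
  refine ⟨τ, ?_, hτ⟩
  let Q := closedBall (0 : V →L[ℝ] W) (1 / 8)
  have : CompactSpace Q := isCompact_iff_compactSpace.1 (isCompact_closedBall _ _)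
  let G : Set (nearAxis V W × Q) :=
    {p | comap (shear (p.2 : V →L[ℝ] W)) (p.1 : ChabautySpace (V × W)) ∈ straightSubgroups V W}
  have hG : IsClosed G := isClosed_straightSubgroups.preimage
    (continuous_comap_shear (by fun_prop) (by fun_prop))
  rw [continuous_iff_isClosed]
  intro s hs
  -- Closed graph argument: by uniqueness of the straightening shear, the preimage of s under τ is
  -- the projection of a closed set along the compact ball `Q`.
  have h1 := isClosedMap_fst_of_compactSpace (X := nearAxis V W) (Y := Q) _
    (hG.inter ((hs.preimage continuous_subtype_val).preimage continuous_snd))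
  convert! h1 using 1
  ext Γ
  constructor
  · intro h
    exact ⟨(Γ, ⟨τ Γ, by simpa [Q] using (hτ Γ).1⟩), ⟨(hτ Γ).2, h⟩, rfl⟩
  · rintro ⟨⟨Γ', ρ, hρ⟩, ⟨h1, h2⟩, rfl⟩
    have := eq_of_comap_shear_mem (hτ Γ').1 (by simpa [Q] using hρ) (hτ Γ').2 h1
    exact (congrArg (· ∈ s) this).mpr h2

/-- At t = 0 both halves of straightness enter: 1-density along V becomes |t|-density after
contraction, and the gap around V × 0 forces elements off the axis to leave every bounded set. -/
theorem continuous_squeeze :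
    Continuous fun p : ℝ × straightSubgroups V W => squeeze p.1 (p.2 : ChabautySpace (V × W)) := by
  rw [continuous_iff_continuousAt]
  rintro ⟨t, Γ⟩
  rcases eq_or_ne t 0 with rfl | ht
  · rw [continuousAt_iff]
    constructor
    · intro v hv O hO
      have hv : v.2 = 0 := by simpa [squeeze_zero] using hv
      obtain ⟨ε, hε, hεO⟩ := Metric.mem_nhds_iff.1 hO
      have h1 : ∀ᶠ p : ℝ × straightSubgroups V W in 𝓝 (0, Γ), |p.1| < ε := by
        have : ContinuousAt (fun p : ℝ × straightSubgroups V W => |p.1|) (0, Γ) := by fun_prop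
        exact this.eventually (by simpa using eventually_lt_nhds hε)
      filter_upwards [h1] with p hp
      rcases eq_or_ne p.1 0 with h0 | h0
      · exact ⟨v, mem_of_mem_nhds hO, by simpa [h0, squeeze_zero] using hv⟩
      obtain ⟨x, hx, hxΓ⟩ := p.2.2.2 (p.1⁻¹ • v.1)
      refine ⟨(p.1 • x, 0), hεO ?_, ?_⟩
      · have h2 : p.1 • x - v.1 = p.1 • (x - p.1⁻¹ • v.1) := by
          rw [smul_sub, smul_inv_smul₀ h0]
        rw [mem_ball, Prod.dist_eq, hv, dist_self, dist_eq_norm]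
        refine max_lt ?_ hε
        change ‖p.1 • x - v.1‖ < ε
        rw [h2, norm_smul, Real.norm_eq_abs]
        nlinarith [abs_nonneg p.1]
      · rw [squeeze, if_neg h0, mem_comap]
        simpa [smul_smul, inv_mul_cancel₀ h0] using hxΓ
    · intro w hw
      have hw : w.2 ≠ 0 := by simpa [squeeze_zero] using hw
      have h1 : ∀ᶠ p : (ℝ × straightSubgroups V W) × (V × W) in 𝓝 ((0, Γ), w),
          ‖p.1.1 • p.2.2‖ < 1 := by
        have : ContinuousAt (fun p : (ℝ × straightSubgroups V W) × (V × W) => ‖p.1.1 • p.2.2‖)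
          ((0, Γ), w) := by fun_prop
        exact this.eventually (by simpa using eventually_lt_nhds one_pos)
      have h2 : ∀ᶠ p : (ℝ × straightSubgroups V W) × (V × W) in 𝓝 ((0, Γ), w), p.2.2 ≠ 0 := by
        have : ContinuousAt (fun p : (ℝ × straightSubgroups V W) × (V × W) => p.2.2)
          ((0, Γ), w) := by fun_prop
        exact this.eventually (eventually_ne_nhds hw)
      filter_upwards [h1, h2] with p hp1 hp2 hp
      rw [squeeze] at hp
      split_ifs at hp with h0
      · exact hp2 hp
      · exact smul_ne_zero h0 hp2 (p.1.2.2.1 _ hp (by simpa using hp1))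
  · have hne : ∀ᶠ p : ℝ × straightSubgroups V W in 𝓝 (t, Γ), p.1 ≠ 0 :=
      continuousAt_fst.eventually (eventually_ne_nhds ht)
    have h1 : ContinuousAt (fun p : ℝ × straightSubgroups V W =>
        comap (stretch p.1⁻¹ p.1) (p.2 : ChabautySpace (V × W))) (t, Γ) :=
      continuousAt_comap_stretch (by fun_prop) (continuousAt_fst.inv₀ ht) continuousAt_fst
        (inv_ne_zero ht) ht
    refine h1.congr ?_
    filter_upwards [hne] with p hp
    rw [squeeze, if_neg hp]

theorem homotopicallyTrivialIn_nearAxis : HomotopicallyTrivialIn (nearAxis V W) := by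
  obtain ⟨τ, hτ, h⟩ := exists_continuous_straightening (V := V) (W := W)
  let g : C(nearAxis V W, ChabautySpace (V × W)) :=
    ⟨fun Γ => comap (shear (τ Γ)) (Γ : ChabautySpace (V × W)),
      continuous_comap_shear continuous_subtype_val hτ⟩
  refine .of_nullhomotopic ⟨axis V W, ContinuousMap.Homotopic.trans (g := g)
    ⟨⟨⟨fun p => comap (shear ((p.1 : ℝ) • τ p.2)) (p.2 : ChabautySpace (V × W)), ?_⟩, ?_, ?_⟩⟩
    (ContinuousMap.Homotopic.symm
      ⟨⟨⟨fun p => squeeze (p.1 : ℝ) (g p.2), ?_⟩, ?_, ?_⟩⟩)⟩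
  · exact continuous_comap_shear (by fun_prop) (by fun_prop)
  · simp [shear_zero]
  · simp [g]
  · exact continuous_squeeze.comp (g := fun p : ℝ × straightSubgroups V W =>
      squeeze p.1 (p.2 : ChabautySpace (V × W)))
      (f := fun p : I × nearAxis V W => ((p.1 : ℝ), ⟨g p.2, (h p.2).2⟩)) (by fun_prop)
  · simp [squeeze_zero]
  · simp [squeeze_one]

end NearAxis

end ChabautySpace

/-! ### Straightenable subgroups form a neighbourhood of V × 0 -/

namespace ChabautySpace

open Filter Metric

section Neighbourhood

variable {V W : Type*} [NormedAddCommGroup V] [NormedSpace ℝ V] [NormedAddCommGroup W]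
  [NormedSpace ℝ W]

theorem exists_basis_sum_norm_le (V : Type*) [NormedAddCommGroup V] [NormedSpace ℝ V]
    [FiniteDimensional ℝ V] {ε : ℝ} (hε : 0 < ε) :
    ∃ b : Module.Basis (Fin (Module.finrank ℝ V)) ℝ V, ∑ i, ‖b i‖ < ε := by
  let b := Module.finBasis ℝ V
  have h0 : 0 ≤ ∑ i, ‖b i‖ := Finset.sum_nonneg fun i _ => norm_nonneg _
  let c : ℝ := ε / (1 + ∑ i, ‖b i‖)
  have hc : 0 < c := by positivity
  refine ⟨b.unitsSMul fun _ => Units.mk0 c hc.ne', ?_⟩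
  have : ∀ i, ‖b.unitsSMul (fun _ => Units.mk0 c hc.ne') i‖ = c * ‖b i‖ := by
    intro i
    rw [Module.Basis.unitsSMul_apply, Units.smul_def, norm_smul, Units.val_mk0,
      Real.norm_of_nonneg hc.le]
  simp only [this, ← Finset.mul_sum]
  rw [div_mul_eq_mul_div, div_lt_iff₀ (by positivity)]
  nlinarith

/-- Rounding the coefficients of a linear combination moves it by at most the sum of the norms. -/
theorem norm_int_combination_sub_le {ι : Type*} [Fintype ι] (a : ι → V) (c : ι → ℝ) :
    ‖∑ i, ⌊c i⌋ • a i - ∑ i, c i • a i‖ ≤ ∑ i, ‖a i‖ := by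
  rw [← Finset.sum_sub_distrib]
  refine norm_sum_le_of_le _ fun i _ => ?_
  rw [← Int.cast_smul_eq_zsmul ℝ, ← sub_smul, norm_smul, norm_sub_rev, Real.norm_eq_abs,
    Int.self_sub_floor, Int.abs_fract]
  exact mul_le_of_le_one_left (norm_nonneg _) (Int.fract_lt_one _).le

variable [FiniteDimensional ℝ V]

/-- A family in `V × W` close to a basis of `V × 0` is contained in the graph of a small linear
map, and spans it. -/
theorem eventually_exists_graph {ι : Type*} [Fintype ι] (b : Module.Basis ι ℝ V) {ε : ℝ}
    (hε : 0 < ε) :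
    ∀ᶠ q : ι → V × W in 𝓝 fun i => (b i, 0), ∃ τ : V →L[ℝ] W, ‖τ‖ ≤ ε ∧
      (∀ i, τ (q i).1 = (q i).2) ∧ ∀ x : V, ∃ c : ι → ℝ, x = ∑ i, c i • (q i).1 := by
  -- `P q` and `R q` send the basis to the two components of q, so τ will be `R q` composed with the
  -- inverse of `P q`. At q₀ these are 1 and 0, hence nearby `P q` is invertible and τ is small.
  let f (i : ι) : V →L[ℝ] ℝ := (b.coord i).toContinuousLinearMap
  let P (q : ι → V × W) : V →L[ℝ] V := ∑ i, (f i).smulRight (q i).1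
  let R (q : ι → V × W) : V →L[ℝ] W := ∑ i, (f i).smulRight (q i).2
  have hPb q j : P q (b j) = (q j).1 := by
    classical
    simp [P, f, Finsupp.single_apply]
  have hRb q j : R q (b j) = (q j).2 := by
    classical
    simp [R, f, Finsupp.single_apply]
  have hP : Continuous P := by
    refine continuous_finsetSum _ fun i _ => ?_
    exact (ContinuousLinearMap.smulRightL ℝ V V (f i)).continuous.comp
      (f := fun q : ι → V × W => (q i).1) (by fun_prop)
  have hR : Continuous R := by
    refine continuous_finsetSum _ fun i _ => ?_
    exact (ContinuousLinearMap.smulRightL ℝ V W (f i)).continuous.comp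
      (f := fun q : ι → V × W => (q i).2) (by fun_prop)
  set q₀ : ι → V × W := fun i => (b i, 0)
  have hP0 : P q₀ = 1 := by
    ext x
    simp [P, f, q₀]
  have hR0 : R q₀ = 0 := by
    ext x
    simp [R, q₀]
  have : CompleteSpace V := FiniteDimensional.complete ℝ V
  have h1 : ∀ᶠ q in 𝓝 q₀, IsUnit (P q) :=
    hP.continuousAt.eventually (Units.isOpen.mem_nhds (by rw [hP0]; exact isUnit_one))
  have h2 : ContinuousAt (fun q => R q ∘L Ring.inverse (P q)) q₀ := by
    refine hR.continuousAt.clm_comp (ContinuousAt.comp (g := Ring.inverse) ?_ hP.continuousAt)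
    rw [hP0]
    exact NormedRing.inverse_continuousAt 1
  have h3 : ∀ᶠ q in 𝓝 q₀, ‖R q ∘L Ring.inverse (P q)‖ < ε :=
    h2.norm.eventually (by simpa [hR0] using eventually_lt_nhds hε)
  filter_upwards [h1, h3] with q hq1 hq3
  refine ⟨_, hq3.le, fun i => ?_, fun x => ⟨fun i => b.repr (Ring.inverse (P q) x) i, ?_⟩⟩
  · have := congrArg (fun T : V →L[ℝ] V => T (b i)) (Ring.inverse_mul_cancel _ hq1)
    simp only [mul_apply_eq_comp, hPb, one_apply_eq_self] at this
    rw [ContinuousLinearMap.comp_apply, this, hRb]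
  · have := congrArg (fun T : V →L[ℝ] V => T x) (Ring.mul_inverse_cancel _ hq1)
    simp only [mul_apply_eq_comp, one_apply_eq_self] at this
    conv_lhs => rw [← this, ← b.sum_repr (Ring.inverse (P q) x), map_sum]
    simp only [map_smul, hPb]

/-- A subgroup near the axis contains vectors close to a short basis of V. They lie on the graph of
a small τ, and after shearing their integer combinations are 1-dense in V × 0. A sheared element too
close to V × 0 but not in it is excluded by a compact set that the axis misses. -/
theorem nearAxis_mem_nhds [FiniteDimensional ℝ W] : nearAxis V W ∈ 𝓝 (axis V W) := by
  obtain ⟨b, hb⟩ := exists_basis_sum_norm_le V one_pos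
  have h1 : ∀ᶠ q : Fin (Module.finrank ℝ V) → V × W in 𝓝 fun i => (b i, 0),
      ∑ i, ‖(q i).1‖ < 1 := by
    have : Continuous fun q : Fin (Module.finrank ℝ V) → V × W => ∑ i, ‖(q i).1‖ := by fun_prop
    exact this.continuousAt.eventually (eventually_lt_nhds hb)
  obtain ⟨δ, hδ, h⟩ := Metric.mem_nhds_iff.1
    (h1.and (eventually_exists_graph (W := W) b (by norm_num : (0 : ℝ) < 1 / 8)))
  have hhit : ∀ᶠ Γ in 𝓝 (axis V W), ∀ i, ∃ v ∈ ball (b i, (0 : W)) δ, v ∈ Γ :=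
    eventually_all.2 fun i => (isOpen_setOf_hits isOpen_ball).mem_nhds
      ⟨_, mem_ball_self hδ, by simp⟩
  have hK : IsCompact (closedBall (0 : V) 1 ×ˢ (closedBall (0 : W) (9 / 8) \ ball 0 (3 / 8))) :=
    (isCompact_closedBall _ _).prod ((isCompact_closedBall _ _).diff isOpen_ball)
  filter_upwards [hhit, (isOpen_setOf_misses hK).mem_nhds fun v hv hvΓ => hv.2.2 (by
    rw [mem_axis.1 hvΓ]; exact mem_ball_self (by norm_num))] with Γ hΓ hmiss
  choose q hq hqΓ using hΓ
  obtain ⟨hq1, τ, hτ, hτq, hspan⟩ := h ((dist_pi_lt_iff hδ).2 hq : q ∈ ball _ δ)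
  have hdense : ∀ x : V, ∃ x' : V, ‖x' - x‖ ≤ 1 ∧ (x', (0 : W)) ∈ comap (shear τ) Γ := by
    intro x
    obtain ⟨c, hc⟩ := hspan x
    refine ⟨∑ i, ⌊c i⌋ • (q i).1, ?_, ?_⟩
    · rw [hc]
      exact (norm_int_combination_sub_le _ c).trans hq1.le
    · have : ∑ i, ⌊c i⌋ • q i ∈ Γ := sum_mem fun i _ => zsmul_mem (hqΓ i) _
      have heq : shear τ (∑ i, ⌊c i⌋ • (q i).1, 0) = ∑ i, ⌊c i⌋ • q i := by
        ext
        · simp [Prod.fst_sum]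
        · simp [Prod.snd_sum, map_sum, hτq]
      rwa [mem_comap, heq]
  refine ⟨τ, hτ, fun v hv hv1 => ?_, hdense⟩
  by_contra hv0
  -- Some multiple of v has W-component of norm in [1/2, 1]. Subtracting (x, 0) brings the
  -- V-component into the unit ball, and shearing back changes the W-component by at most 1/8; hence
  -- the radii 3/8 and 9/8 of the missed set.
  obtain ⟨k, hk1, hk2⟩ := exists_nat_mul_norm_mem_Icc hv0 hv1.le
  obtain ⟨x, hx, hxΓ⟩ := hdense (k • v.1)
  have h2 : shear τ (k • v - (x, 0)) ∈ Γ := sub_mem (nsmul_mem hv k) hxΓ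
  have h3 : ‖τ (k • v.1 - x)‖ ≤ 1 / 8 :=
    (τ.le_opNorm _).trans (by
      rw [norm_sub_rev]
      nlinarith [norm_nonneg τ, norm_nonneg (x - k • v.1)])
  refine hmiss _ ⟨?_, ?_, ?_⟩ h2
  · simpa [norm_sub_rev] using hx
  · have := norm_add_le (k • v.2) (τ (k • v.1 - x))
    simp only [shear_apply, mem_closedBall_zero_iff, Prod.snd_sub, Prod.smul_snd, Prod.fst_sub,
      Prod.smul_fst, sub_zero]
    linarith
  · have := norm_sub_norm_le (k • v.2) (-τ (k • v.1 - x))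
    rw [norm_neg, sub_neg_eq_add] at this
    simp only [shear_apply, mem_ball_zero_iff, Prod.snd_sub, Prod.smul_snd, Prod.fst_sub,
      Prod.smul_fst, sub_zero, not_lt]
    linarith

end Neighbourhood

/-! ### The largest linear subspace as a limit of expansions -/

section MaxSubspace

variable {E : Type*} [NormedAddCommGroup E] [NormedSpace ℝ E]

/-- The largest linear subspace contained in a closed subgroup. -/
def maxSubspace (Γ : ChabautySpace E) : Submodule ℝ E where
  carrier := {v | ∀ s : ℝ, s • v ∈ Γ}
  add_mem' hv hw s := by rw [smul_add]; exact add_mem (hv s) (hw s)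
  zero_mem' s := by rw [smul_zero]; exact zero_mem _
  smul_mem' c v hv s := by rw [smul_smul]; exact hv _

theorem mem_maxSubspace {Γ : ChabautySpace E} {v : E} :
    v ∈ maxSubspace Γ ↔ ∀ s : ℝ, s • v ∈ Γ := Iff.rfl

theorem maxSubspace_subset {Γ : ChabautySpace E} {v : E} (hv : v ∈ maxSubspace Γ) : v ∈ Γ := by
  simpa using hv 1

theorem tendsto_floor_div_mul (s : ℝ) :
    Tendsto (fun t : ℝ => (⌊s / t⌋ : ℝ) * t) (𝓝[>] 0) (𝓝 s) := by
  have h0 : Tendsto (fun t : ℝ => s - t) (𝓝[>] 0) (𝓝 s) := by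
    have : Tendsto (fun t : ℝ => s - t) (𝓝 0) (𝓝 (s - 0)) := by
      exact (continuous_const.sub continuous_id).continuousAt
    rw [sub_zero] at this
    exact this.mono_left nhdsWithin_le_nhds
  refine tendsto_of_tendsto_of_tendsto_of_le_of_le' h0 tendsto_const_nhds ?_ ?_
  · filter_upwards [self_mem_nhdsWithin] with t (ht : 0 < t)
    have := (Int.sub_one_lt_floor (s / t)).le
    have h2 : s / t * t = s := div_mul_cancel₀ _ ht.ne'
    nlinarith
  · filter_upwards [self_mem_nhdsWithin] with t (ht : 0 < t)
    have := Int.floor_le (s / t)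
    have h2 : s / t * t = s := div_mul_cancel₀ _ ht.ne'
    nlinarith

variable [FiniteDimensional ℝ E]

/-- A linear subspace, as a closed subgroup. -/
def ofSubmodule (V : Submodule ℝ E) : ChabautySpace E where
  toAddSubgroup := V.toAddSubgroup
  isClosed' := V.closed_of_finiteDimensional

@[simp]
theorem mem_ofSubmodule {V : Submodule ℝ E} {v : E} : v ∈ ofSubmodule V ↔ v ∈ V := Iff.rfl

/-- Under expansion a closed subgroup converges to its largest linear subspace. -/
theorem tendsto_comap_smul (Γ : ChabautySpace E) :
    Tendsto (fun t : ℝ => comap (t • .id ℝ E) Γ) (𝓝[>] 0) (𝓝 (ofSubmodule (maxSubspace Γ))) := by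
  rw [tendsto_nhds_iff]
  refine ⟨fun v hv O hO => .of_forall fun t => ⟨v, mem_of_mem_nhds hO, hv t⟩, fun w hw => ?_⟩
  rw [mem_ofSubmodule, mem_maxSubspace, not_forall] at hw
  obtain ⟨s, hs⟩ := hw
  -- Some s • w lies outside Γ. If t • u is in Γ with u near w, its multiple by ⌊s / t⌋ is in Γ and
  -- close to s • w, which is impossible for small t because Γ is closed.
  have h1 : Tendsto (fun p : ℝ × E => ((⌊s / p.1⌋ : ℝ) * p.1) • p.2) (𝓝[>] 0 ×ˢ 𝓝 w)
      (𝓝 (s • w)) := ((tendsto_floor_div_mul s).comp tendsto_fst).smul tendsto_snd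
  filter_upwards [h1 (Γ.isClosed_coe.isOpen_compl.mem_nhds hs)] with p hp hpΓ
  refine hp ?_
  have := zsmul_mem hpΓ ⌊s / p.1⌋
  rw [← Int.cast_smul_eq_zsmul ℝ] at this
  simpa [smul_smul] using this

/-- The expansions of Γ converge to the trivial subgroup, so some expansion has no short nonzero
vectors; rescaling gives the same for Γ. -/
theorem mem_discreteSubgroups_of_maxSubspace_eq_bot {Γ : ChabautySpace E}
    (h : maxSubspace Γ = ⊥) : Γ ∈ discreteSubgroups E := by
  have h1 := tendsto_comap_smul Γ
  rw [h] at h1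
  obtain ⟨r, hr, h2⟩ := eventually_forall_norm_lt (Γ := ofSubmodule (⊥ : Submodule ℝ E))
    ⟨1, one_pos, fun v hv _ => hv⟩
  obtain ⟨t, ht, ht0⟩ := ((h1.eventually h2).and self_mem_nhdsWithin).exists
  have ht0 : 0 < t := ht0
  refine ⟨t * r, by positivity, fun v hv hvr => ?_⟩
  have := ht (t⁻¹ • v) (by simpa [smul_smul, ht0.ne'] using hv) (by
    rw [norm_smul, Real.norm_of_nonneg (by positivity), inv_mul_lt_iff₀ ht0]
    exact hvr)
  simpa [ht0.ne'] using this

end MaxSubspace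

end ChabautySpace

/-! ### Paths of invertible matrices -/

section SignMatrix

open Matrix

/-- An invertible real matrix can be moved through invertible matrices to a diagonal matrix with
entries `1` and `-1`. -/
theorem Matrix.exists_path_to_signs {ι : Type*} [Fintype ι] [DecidableEq ι] (M : Matrix ι ι ℝ)
    (hM : M.det ≠ 0) :
    ∃ (γ : I → Matrix ι ι ℝ) (ε : ι → ℤˣ), Continuous γ ∧ (∀ t, (γ t).det ≠ 0) ∧ γ 0 = M ∧
      γ 1 = diagonal fun i => ((ε i : ℤ) : ℝ) := by
  refine Matrix.diagonal_transvection_induction_of_det_ne_zero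
    (fun M => ∃ (γ : I → Matrix ι ι ℝ) (ε : ι → ℤˣ), Continuous γ ∧ (∀ t, (γ t).det ≠ 0) ∧
      γ 0 = M ∧ γ 1 = diagonal fun i => ((ε i : ℤ) : ℝ)) M hM ?_ ?_ ?_
  · intro D hD
    have hD' : ∀ i, D i ≠ 0 := by
      simpa [det_diagonal, Finset.prod_ne_zero_iff] using hD
    have hsign (i : ι) : ∃ e : ℤˣ, 0 < D i * ((e : ℤ) : ℝ) := by
      rcases (hD' i).lt_or_gt with h | h
      · exact ⟨-1, by simpa using h⟩
      · exact ⟨1, by simpa using h⟩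
    choose e he using hsign
    -- Each diagonal entry moves linearly to the unit of the same sign, so it never vanishes.
    refine ⟨fun t => diagonal fun i => (1 - (t : ℝ)) * D i + t * ((e i : ℤ) : ℝ), e, ?_, ?_, ?_, ?_⟩
    · exact Continuous.matrix_diagonal (by fun_prop)
    · intro t
      rw [det_diagonal, Finset.prod_ne_zero_iff]
      intro i _ h0
      have h1 : (1 - (t : ℝ)) * (D i * D i) + t * (D i * ((e i : ℤ) : ℝ)) = 0 := by
        linear_combination D i * h0
      have h2 : 0 < D i * D i := mul_self_pos.2 (hD' i)
      nlinarith [t.2.1, t.2.2, he i, mul_nonneg (sub_nonneg.2 t.2.2) h2.le,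
        mul_nonneg t.2.1 (he i).le]
    · simp
    · simp
  · intro T
    -- Shrinking the off-diagonal coefficient to 0 keeps the determinant equal to 1.
    refine ⟨fun t => transvection T.i T.j ((1 - (t : ℝ)) * T.c), 1, ?_, ?_, ?_, ?_⟩
    · unfold transvection
      refine continuous_const.add (continuous_matrix fun i j => ?_)
      simp only [single_apply]
      split_ifs <;> fun_prop
    · intro t
      simp [det_transvection_of_ne _ _ T.hij]
    · simp [TransvectionStruct.toMatrix]
    · simp
  · intro A B _ _ hA hB
    obtain ⟨γ, ε, h1, h2, h3, h4⟩ := hA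
    obtain ⟨γ', ε', h1', h2', h3', h4'⟩ := hB
    refine ⟨fun t => γ t * γ' t, fun i => ε i * ε' i, h1.matrix_mul h1', ?_, by simp [h3, h3'], ?_⟩
    · intro t
      rw [det_mul]
      exact mul_ne_zero (h2 t) (h2' t)
    · simp [h4, h4', diagonal_mul_diagonal]

end SignMatrix

/-! ### Lattices in ℝᵖ × 0 and their connectedness -/

namespace ChabautySpace

open Filter Metric

section Lattice

variable {p : ℕ} {W : Type*} [NormedAddCommGroup W]

theorem eq_zero_of_integral_of_norm_lt_one {x : Fin p → ℝ} (hx : ∀ i, x i ∈ Set.range ((↑) : ℤ → ℝ))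
    (h : ‖x‖ < 1) : x = 0 := by
  ext i
  obtain ⟨k, hk⟩ := hx i
  have h1 : |(k : ℝ)| < 1 := by
    rw [hk]
    exact (norm_le_pi_norm x i).trans_lt h
  have h2 : k = 0 := Int.abs_lt_one_iff.1 (by exact_mod_cast h1)
  rw [← hk, h2, Int.cast_zero, Pi.zero_apply]

/-- The subgroup of the elements of `ℝᵖ × W` whose first component is integral and whose second
component is in a given closed subgroup. -/
def intProd (p : ℕ) (Λ : ChabautySpace W) : ChabautySpace ((Fin p → ℝ) × W) where
  carrier := {v | (∀ i, v.1 i ∈ Set.range ((↑) : ℤ → ℝ)) ∧ v.2 ∈ Λ}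
  add_mem' hv hw := ⟨fun i => by
    obtain ⟨k, hk⟩ := hv.1 i
    obtain ⟨l, hl⟩ := hw.1 i
    exact ⟨k + l, by simp [hk, hl]⟩, add_mem hv.2 hw.2⟩
  zero_mem' := ⟨fun _ => ⟨0, by simp⟩, zero_mem _⟩
  neg_mem' hv := ⟨fun i => by
    obtain ⟨k, hk⟩ := hv.1 i
    exact ⟨-k, by simp [hk]⟩, neg_mem hv.2⟩
  isClosed' := by
    have h : {v : (Fin p → ℝ) × W | ∀ i, v.1 i ∈ Set.range ((↑) : ℤ → ℝ)} =
        ⋂ i, (fun v : (Fin p → ℝ) × W => v.1 i) ⁻¹' Set.range ((↑) : ℤ → ℝ) := by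
      ext
      simp
    have hcl : IsClosed {v : (Fin p → ℝ) × W | ∀ i, v.1 i ∈ Set.range ((↑) : ℤ → ℝ)} := by
      rw [h]
      exact isClosed_iInter fun i =>
        Int.isClosedEmbedding_coe_real.isClosed_range.preimage (by fun_prop)
    exact hcl.inter (Λ.isClosed_coe.preimage continuous_snd)

theorem mem_intProd {Λ : ChabautySpace W} {v : (Fin p → ℝ) × W} :
    v ∈ intProd p Λ ↔ (∀ i, v.1 i ∈ Set.range ((↑) : ℤ → ℝ)) ∧ v.2 ∈ Λ := Iff.rfl

theorem intProd_mem_discreteSubgroups {Λ : ChabautySpace W} (hΛ : Λ ∈ discreteSubgroups W) :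
    intProd p Λ ∈ discreteSubgroups ((Fin p → ℝ) × W) := by
  obtain ⟨r, hr, h⟩ := hΛ
  refine ⟨min 1 r, lt_min one_pos hr, fun v hv hvr => Prod.ext ?_ ?_⟩
  · exact eq_zero_of_integral_of_norm_lt_one hv.1
      ((norm_fst_le v).trans_lt (hvr.trans_le (min_le_left _ _)))
  · exact h _ hv.2 ((norm_snd_le v).trans_lt (hvr.trans_le (min_le_right _ _)))

theorem norm_floor_sub_le (x : Fin p → ℝ) : ‖(fun i => (⌊x i⌋ : ℝ)) - x‖ ≤ 1 := by
  rw [pi_norm_le_iff_of_nonneg zero_le_one]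
  intro i
  rw [Pi.sub_apply, norm_sub_rev, Real.norm_eq_abs, Int.self_sub_floor, Int.abs_fract]
  exact (Int.fract_lt_one _).le

variable [NormedSpace ℝ W]

/-- A matrix acting on the first factor of `ℝᵖ × W`. -/
noncomputable def matrixAction (W : Type*) [NormedAddCommGroup W] [NormedSpace ℝ W]
    (M : Matrix (Fin p) (Fin p) ℝ) : (Fin p → ℝ) × W →L[ℝ] (Fin p → ℝ) × W :=
  (LinearMap.toContinuousLinearMap (Matrix.toLin' M)).prodMap (.id ℝ W)

@[simp]
theorem matrixAction_apply (M : Matrix (Fin p) (Fin p) ℝ) (v : (Fin p → ℝ) × W) :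
    matrixAction W M v = (M.mulVec v.1, v.2) := rfl

theorem continuous_toLin :
    Continuous fun M : Matrix (Fin p) (Fin p) ℝ =>
      LinearMap.toContinuousLinearMap (Matrix.toLin' M) :=
  LinearMap.continuous_of_finiteDimensional
    ((LinearMap.toContinuousLinearMap (𝕜 := ℝ) (E := Fin p → ℝ) (F' := Fin p → ℝ)).toLinearMap ∘ₗ
      (Matrix.toLin' (R := ℝ) (m := Fin p) (n := Fin p)).toLinearMap)

theorem continuous_matrixAction :
    Continuous (matrixAction W : Matrix (Fin p) (Fin p) ℝ → _) :=
  (ContinuousLinearMap.prodMapL ℝ (Fin p → ℝ) (Fin p → ℝ) W W).continuous.comp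
    (continuous_toLin.prodMk continuous_const)

theorem matrixAction_injective {M : Matrix (Fin p) (Fin p) ℝ} (hM : M.det ≠ 0) :
    Function.Injective (matrixAction W M) := by
  intro v w h
  rw [matrixAction_apply, matrixAction_apply, Prod.mk.injEq] at h
  exact Prod.ext (Matrix.mulVec_injective_of_isUnit
    ((Matrix.isUnit_iff_isUnit_det _).2 hM.isUnit) h.1) h.2

/-- The lattice in `ℝᵖ × 0` of the vectors that the matrix `M` makes integral. -/
noncomputable def lattice (W : Type*) [NormedAddCommGroup W] [NormedSpace ℝ W]
    (M : Matrix (Fin p) (Fin p) ℝ) : ChabautySpace ((Fin p → ℝ) × W) :=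
  comap (matrixAction W M) (intProd p (trivialSubgroup W))

theorem mem_lattice {M : Matrix (Fin p) (Fin p) ℝ} {v : (Fin p → ℝ) × W} :
    v ∈ lattice W M ↔ (∀ i, M.mulVec v.1 i ∈ Set.range ((↑) : ℤ → ℝ)) ∧ v.2 = 0 := Iff.rfl

theorem lattice_mem_discreteSubgroups {M : Matrix (Fin p) (Fin p) ℝ} (hM : M.det ≠ 0) :
    lattice W M ∈ discreteSubgroups ((Fin p → ℝ) × W) :=
  comap_mem_discreteSubgroups (matrixAction_injective hM)
    (intProd_mem_discreteSubgroups ⟨1, one_pos, fun _ hv _ => hv⟩)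

/-- Integrality of a coordinate does not depend on its sign. This is what connects the lattices
coming from the two components of GL(p, ℝ). -/
theorem lattice_signs (ε : Fin p → ℤˣ) :
    lattice W (Matrix.diagonal fun i => ((ε i : ℤ) : ℝ)) = lattice W 1 := by
  refine SetLike.ext fun v => ?_
  simp only [mem_lattice, Matrix.mulVec_diagonal, Matrix.one_mulVec]
  refine and_congr_left' (forall_congr' fun i => ?_)
  rcases Int.units_eq_one_or (ε i) with h | h
  · simp [h]
  · rw [h]
    simp only [Units.val_neg, Units.val_one, Int.cast_neg, Int.cast_one, neg_mul, one_mul]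
    exact ⟨fun ⟨k, hk⟩ => ⟨-k, by simp [hk]⟩, fun ⟨k, hk⟩ => ⟨-k, by simp [hk]⟩⟩

theorem lattice_mem_straightSubgroups {M : Matrix (Fin p) (Fin p) ℝ} (hM : M.det ≠ 0)
    (h : ‖LinearMap.toContinuousLinearMap (Matrix.toLin' M⁻¹)‖ ≤ 1) :
    lattice W M ∈ straightSubgroups (Fin p → ℝ) W := by
  refine ⟨fun v hv _ => hv.2, fun x => ?_⟩
  -- Round the coordinates of x in the lattice basis; the error, at most 1, is then mapped by the
  -- inverse of M, whose norm is at most 1.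
  set y : Fin p → ℝ := fun i => (⌊M.mulVec x i⌋ : ℝ) with hy
  refine ⟨M⁻¹.mulVec y, ?_, fun i => ⟨⌊M.mulVec x i⌋, ?_⟩, rfl⟩
  · have h1 : M⁻¹.mulVec y - x =
        LinearMap.toContinuousLinearMap (Matrix.toLin' M⁻¹) (y - M.mulVec x) := by
      simp [Matrix.mulVec_sub, Matrix.nonsing_inv_mul _ hM.isUnit]
    rw [h1]
    exact (ContinuousLinearMap.le_opNorm _ _).trans
      (mul_le_one₀ h (norm_nonneg _) (norm_floor_sub_le _))
  · simp [hy, Matrix.mul_nonsing_inv _ hM.isUnit]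

theorem lattice_smul_mem_straightSubgroups {M : Matrix (Fin p) (Fin p) ℝ} {c : ℝ} (hc : 1 ≤ c)
    (h : lattice W M ∈ straightSubgroups (Fin p → ℝ) W) :
    lattice W (c • M) ∈ straightSubgroups (Fin p → ℝ) W := by
  have hc0 : 0 < c := one_pos.trans_le hc
  refine ⟨fun v hv _ => hv.2, fun x => ?_⟩
  obtain ⟨y, hy, hyΓ⟩ := h.2 (c • x)
  refine ⟨c⁻¹ • y, ?_, fun i => ?_, rfl⟩
  · have : c⁻¹ • y - x = c⁻¹ • (y - c • x) := by rw [smul_sub, inv_smul_smul₀ hc0.ne']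
    rw [this, norm_smul, Real.norm_of_nonneg (by positivity)]
    exact mul_le_one₀ (inv_le_one_of_one_le₀ hc) (norm_nonneg _) hy
  · simpa [Matrix.smul_mulVec, Matrix.mulVec_smul, hc0.ne'] using hyΓ.1 i

/-- A discrete subgroup of `ℝᵖ × 0` that is cobounded there is the lattice of a matrix. -/
theorem exists_eq_lattice {Γ : ChabautySpace ((Fin p → ℝ) × W)}
    (hD : Γ ∈ discreteSubgroups ((Fin p → ℝ) × W)) (hS : Γ ∈ straightSubgroups (Fin p → ℝ) W)
    (h0 : ∀ v ∈ Γ, v.2 = 0) :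
    ∃ M : Matrix (Fin p) (Fin p) ℝ, M.det ≠ 0 ∧ Γ = lattice W M := by
  let L : Submodule ℤ (Fin p → ℝ) := AddSubgroup.toIntSubmodule
    (comap (.inl ℝ (Fin p → ℝ) W) Γ).toAddSubgroup
  have hL {x : Fin p → ℝ} : x ∈ L ↔ (x, (0 : W)) ∈ Γ := Iff.rfl
  have hdisc : DiscreteTopology L := by
    obtain ⟨r, hr, h⟩ := hD
    refine discreteTopology_of_isOpen_singleton_zero ?_
    convert! (isOpen_ball (x := (0 : Fin p → ℝ)) (ε := r)).preimage
      (continuous_subtype_val : Continuous ((↑) : L → Fin p → ℝ)) using 1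
    ext x
    refine ⟨fun hx => by simpa [Set.mem_singleton_iff.1 hx] using hr, fun hx => ?_⟩
    have h1 := h _ (hL.1 x.2) (by simpa using hx)
    exact Subtype.ext (congrArg Prod.fst h1)
  have hspan : Submodule.span ℝ (L : Set (Fin p → ℝ)) = ⊤ := by
    rw [eq_top_iff]
    intro x _
    have hcl := (Submodule.span ℝ (L : Set (Fin p → ℝ))).closed_of_finiteDimensional
    rw [← SetLike.mem_coe, ← hcl.closure_eq, Metric.mem_closure_iff]
    intro ε hε
    -- Enlarging x by 2/ε and scaling the nearby lattice point back gives error at most ε/2, so the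
    -- span of L is dense; it is also closed.
    obtain ⟨y, hy, hyΓ⟩ := hS.2 ((2 / ε) • x)
    refine ⟨(ε / 2) • y, Submodule.smul_mem _ _ (Submodule.subset_span hyΓ), ?_⟩
    have : x - (ε / 2) • y = -((ε / 2) • (y - (2 / ε) • x)) := by
      rw [smul_sub, smul_smul, div_mul_div_cancel₀ (by norm_num), div_self hε.ne', one_smul, neg_sub]
    rw [dist_eq_norm, this, norm_neg, norm_smul, Real.norm_of_nonneg (by positivity)]
    nlinarith
  have hlat : IsZLattice ℝ L := ⟨hspan⟩
  let b := (IsZLattice.basis L).ofZLatticeBasis ℝ L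
  have hb : Submodule.span ℤ (Set.range b) = L := (IsZLattice.basis L).ofZLatticeBasis_span ℝ
  let M := LinearMap.toMatrix' b.equivFun.toLinearMap
  let N := LinearMap.toMatrix' b.equivFun.symm.toLinearMap
  have hMN : M * N = 1 := by
    rw [← LinearMap.toMatrix'_comp]
    simp
  have hM (x : Fin p → ℝ) : M.mulVec x = b.equivFun x := LinearMap.toMatrix'_mulVec _ _
  refine ⟨M, fun h => ?_, SetLike.ext fun v => ?_⟩
  · have := congrArg Matrix.det hMN
    rw [Matrix.det_mul, h, zero_mul, Matrix.det_one] at this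
    exact zero_ne_one this
  · have h1 : v.1 ∈ L ↔ ∀ i, M.mulVec v.1 i ∈ Set.range ((↑) : ℤ → ℝ) := by
      rw [← hb, b.mem_span_iff_repr_mem ℤ, hM]
      rfl
    rw [mem_lattice, ← h1, hL]
    exact ⟨fun h => ⟨by rw [← h0 v h]; exact h, h0 v h⟩, fun h => by
      have := h.1
      rw [← h.2] at this
      exact this⟩

theorem continuous_matrix_inv {γ : I → Matrix (Fin p) (Fin p) ℝ} (hγ : Continuous γ)
    (hdet : ∀ t, (γ t).det ≠ 0) : Continuous fun t => (γ t)⁻¹ := by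
  refine continuous_iff_continuousAt.2 fun t => (continuousAt_matrix_inv _ ?_).comp hγ.continuousAt
  rw [Ring.inverse_eq_inv']
  exact continuousAt_inv₀ (hdet t)

/-- Along a path of matrices the lattices become straight when they are contracted. -/
theorem exists_forall_lattice_smul_mem {γ : I → Matrix (Fin p) (Fin p) ℝ} (hγ : Continuous γ)
    (hdet : ∀ t, (γ t).det ≠ 0) :
    ∃ c : ℝ, 1 ≤ c ∧ ∀ t, lattice W (c • γ t) ∈ straightSubgroups (Fin p → ℝ) W := by
  -- The norms of the inverse matrices are bounded on the compact interval; scaling by c at least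
  -- that bound makes all of them at most 1.
  obtain ⟨C, hC⟩ := (isCompact_range
    (continuous_norm.comp (continuous_toLin.comp (continuous_matrix_inv hγ hdet)))).bddAbove
  have hc : 1 ≤ max 1 C := le_max_left _ _
  have hc0 : 0 < max 1 C := one_pos.trans_le hc
  refine ⟨max 1 C, hc, fun t => lattice_mem_straightSubgroups ?_ ?_⟩
  · rw [Matrix.det_smul]
    exact mul_ne_zero (pow_ne_zero _ hc0.ne') (hdet t)
  · have h2 : (max 1 C • γ t)⁻¹ = (max 1 C)⁻¹ • (γ t)⁻¹ := Matrix.inv_eq_left_inv (by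
      rw [Matrix.smul_mul, Matrix.mul_smul, Matrix.nonsing_inv_mul _ (hdet t).isUnit, smul_smul,
        inv_mul_cancel₀ hc0.ne', one_smul])
    have h3 : ‖LinearMap.toContinuousLinearMap (Matrix.toLin' (γ t)⁻¹)‖ ≤ max 1 C :=
      (hC ⟨t, rfl⟩).trans (le_max_right _ _)
    rw [h2, map_smul, map_smul, norm_smul, Real.norm_of_nonneg (by positivity),
      inv_mul_le_iff₀ hc0, mul_one]
    exact h3

theorem lattice_one_mem_straightSubgroups :
    lattice W (1 : Matrix (Fin p) (Fin p) ℝ) ∈ straightSubgroups (Fin p → ℝ) W := by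
  refine lattice_mem_straightSubgroups (by simp) ?_
  rw [inv_one, Matrix.toLin'_one]
  exact ContinuousLinearMap.norm_id_le

variable [FiniteDimensional ℝ W]

theorem joinedIn_lattice {γ : I → Matrix (Fin p) (Fin p) ℝ} (hγ : Continuous γ)
    (hdet : ∀ t, (γ t).det ≠ 0) (h : ∀ t, lattice W (γ t) ∈ straightSubgroups (Fin p → ℝ) W) :
    JoinedIn (straightSubgroups (Fin p → ℝ) W ∩ discreteSubgroups ((Fin p → ℝ) × W))
      (lattice W (γ 0)) (lattice W (γ 1)) := by
  have hinv := continuous_matrix_inv hγ hdet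
  refine ⟨⟨⟨fun t => lattice W (γ t), ?_⟩, rfl, rfl⟩, fun t =>
    ⟨h t, lattice_mem_discreteSubgroups (hdet t)⟩⟩
  refine continuous_comap (B := fun t => matrixAction W (γ t)⁻¹) continuous_const
    (continuous_matrixAction.comp hγ) (continuous_matrixAction.comp hinv) ?_ ?_
  · intro t u
    simp [Matrix.mul_nonsing_inv _ (hdet t).isUnit]
  · intro t u
    simp [Matrix.nonsing_inv_mul _ (hdet t).isUnit]

theorem joinedIn_lattice_smul {M : Matrix (Fin p) (Fin p) ℝ} (hM : M.det ≠ 0) {c : ℝ}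
    (hc : 1 ≤ c) (h : lattice W M ∈ straightSubgroups (Fin p → ℝ) W) :
    JoinedIn (straightSubgroups (Fin p → ℝ) W ∩ discreteSubgroups ((Fin p → ℝ) × W))
      (lattice W M) (lattice W (c • M)) := by
  have h1 (t : I) : 1 ≤ 1 + (t : ℝ) * (c - 1) := by
    nlinarith [t.2.1, mul_nonneg t.2.1 (sub_nonneg.2 hc)]
  have := joinedIn_lattice (W := W) (γ := fun t : I => (1 + (t : ℝ) * (c - 1)) • M) (by fun_prop)
    (fun t => by
      rw [Matrix.det_smul]
      exact mul_ne_zero (pow_ne_zero _ (one_pos.trans_le (h1 t)).ne') hM)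
    (fun t => lattice_smul_mem_straightSubgroups (h1 t) h)
  simpa using this

/-- The path from M to a sign matrix need not consist of straight lattices. Contracting by a large c
first, following the path scaled by c, and undoing the contraction at the end keeps straightness
throughout. -/
theorem joinedIn_lattice_one {M : Matrix (Fin p) (Fin p) ℝ} (hM : M.det ≠ 0)
    (h : lattice W M ∈ straightSubgroups (Fin p → ℝ) W) :
    JoinedIn (straightSubgroups (Fin p → ℝ) W ∩ discreteSubgroups ((Fin p → ℝ) × W))
      (lattice W M) (lattice W 1) := by
  obtain ⟨γ, ε, hγ, hdet, h0, h1⟩ := Matrix.exists_path_to_signs M hM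
  obtain ⟨c, hc, hst⟩ := exists_forall_lattice_smul_mem (W := W) hγ hdet
  have hone := lattice_one_mem_straightSubgroups (p := p) (W := W)
  rw [← lattice_signs ε, ← h1] at hone ⊢
  have h2 := joinedIn_lattice (γ := fun t => c • γ t) (hγ.const_smul c) (fun t => by
    rw [Matrix.det_smul]
    exact mul_ne_zero (pow_ne_zero _ (one_pos.trans_le hc).ne') (hdet t)) hst
  rw [h0] at h2
  exact ((joinedIn_lattice_smul hM hc h).trans h2).trans
    (joinedIn_lattice_smul (hdet 1) hc hone).symm

end Lattice

end ChabautySpace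

/-! ### Flattening straight subgroups into V × 0 -/

namespace ChabautySpace

open Filter Metric

section Flatten

variable {V W : Type*} [NormedAddCommGroup V] [NormedSpace ℝ V] [NormedAddCommGroup W]
  [NormedSpace ℝ W]

/-- The subgroup `Γ` expanded by the factor `t⁻¹` along `W`; at `t = 0` the part of `Γ` in
`V × 0`. -/
noncomputable def flatten (t : ℝ) (Γ : ChabautySpace (V × W)) : ChabautySpace (V × W) :=
  if t = 0 then Γ ⊓ axis V W else comap (stretch 1 t) Γ

theorem mem_flatten_zero {Γ : ChabautySpace (V × W)} {v : V × W} :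
    v ∈ flatten 0 Γ ↔ v ∈ Γ ∧ v.2 = 0 := by
  rw [flatten, if_pos rfl]
  rfl

theorem mem_flatten {t : ℝ} (ht : t ≠ 0) {Γ : ChabautySpace (V × W)} {v : V × W} :
    v ∈ flatten t Γ ↔ (v.1, t • v.2) ∈ Γ := by
  rw [flatten, if_neg ht, mem_comap, stretch_apply, one_smul]

theorem flatten_one (Γ : ChabautySpace (V × W)) : flatten 1 Γ = Γ :=
  SetLike.ext fun v => by rw [mem_flatten one_ne_zero, one_smul]

theorem flatten_mem_straightSubgroups {t : ℝ} (ht : |t| ≤ 1) {Γ : ChabautySpace (V × W)}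
    (h : Γ ∈ straightSubgroups V W) : flatten t Γ ∈ straightSubgroups V W := by
  rcases eq_or_ne t 0 with rfl | ht0
  · refine ⟨fun v hv _ => (mem_flatten_zero.1 hv).2, fun x => ?_⟩
    obtain ⟨y, hy, hyΓ⟩ := h.2 x
    exact ⟨y, hy, mem_flatten_zero.2 ⟨hyΓ, rfl⟩⟩
  · refine ⟨fun v hv hv1 => ?_, fun x => ?_⟩
    · refine (smul_eq_zero.1 (h.1 _ ((mem_flatten ht0).1 hv) ?_)).resolve_left ht0
      rw [norm_smul, Real.norm_eq_abs]
      exact (mul_le_of_le_one_left (norm_nonneg _) ht).trans_lt hv1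
    · obtain ⟨y, hy, hyΓ⟩ := h.2 x
      exact ⟨y, hy, (mem_flatten ht0).2 (by simpa using hyΓ)⟩

theorem flatten_mem_discreteSubgroups (t : ℝ) {Γ : ChabautySpace (V × W)}
    (h : Γ ∈ discreteSubgroups (V × W)) : flatten t Γ ∈ discreteSubgroups (V × W) := by
  rcases eq_or_ne t 0 with rfl | ht0
  · obtain ⟨r, hr, h⟩ := h
    exact ⟨r, hr, fun v hv => h v (mem_flatten_zero.1 hv).1⟩
  · rw [flatten, if_neg ht0]
    exact comap_mem_discreteSubgroups (stretch_injective one_ne_zero ht0) h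

variable [FiniteDimensional ℝ V] [FiniteDimensional ℝ W]

/-- At t = 0, elements of Γ in V × 0 persist in every flattening, while the gap around V × 0 pushes
all other elements off to infinity. -/
theorem continuous_flatten {Γ : ChabautySpace (V × W)} (h : Γ ∈ straightSubgroups V W) :
    Continuous fun t : ℝ => flatten t Γ := by
  rw [continuous_iff_continuousAt]
  intro t
  rcases eq_or_ne t 0 with rfl | ht
  · rw [continuousAt_iff]
    refine ⟨fun v hv O hO => .of_forall fun t => ⟨v, mem_of_mem_nhds hO, ?_⟩, fun w hw => ?_⟩
    · rcases eq_or_ne t 0 with rfl | ht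
      · exact hv
      · have hv := mem_flatten_zero.1 hv
        rw [mem_flatten ht, hv.2, smul_zero, ← hv.2]
        exact hv.1
    · rw [mem_flatten_zero, not_and_or] at hw
      by_cases hw2 : w.2 = 0
      · have hw : w ∉ Γ := hw.resolve_right (not_not.2 hw2)
        have hΓ := Γ.isClosed_coe.isOpen_compl.mem_nhds hw
        have h1 : ∀ᶠ q : ℝ × (V × W) in 𝓝 (0, w), q.2 ∉ Γ :=
          (continuousAt_snd (p := ((0 : ℝ), w))).eventually (p := fun u => u ∉ Γ) hΓ
        have h2 : ∀ᶠ q : ℝ × (V × W) in 𝓝 (0, w), (q.2.1, q.1 • q.2.2) ∉ Γ := by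
          have : ContinuousAt (fun q : ℝ × (V × W) => (q.2.1, q.1 • q.2.2)) (0, w) := by fun_prop
          have h0 : (w.1, (0 : ℝ) • w.2) = w := by rw [zero_smul, ← hw2]
          exact this.eventually (p := fun u => u ∉ Γ) (by
            change (Γ : Set (V × W))ᶜ ∈ 𝓝 (w.1, (0 : ℝ) • w.2)
            rwa [h0])
        filter_upwards [h1, h2] with q hq1 hq2 hq
        by_cases hq0 : q.1 = 0
        · rw [hq0] at hq
          exact hq1 (mem_flatten_zero.1 hq).1
        · exact hq2 ((mem_flatten hq0).1 hq)
      · have h1 : ∀ᶠ q : ℝ × (V × W) in 𝓝 (0, w), ‖q.1 • q.2.2‖ < 1 := by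
          have : ContinuousAt (fun q : ℝ × (V × W) => ‖q.1 • q.2.2‖) (0, w) := by fun_prop
          exact this.eventually (by simpa using eventually_lt_nhds one_pos)
        have h2 : ∀ᶠ q : ℝ × (V × W) in 𝓝 (0, w), q.2.2 ≠ 0 := by
          have : ContinuousAt (fun q : ℝ × (V × W) => q.2.2) (0, w) := by fun_prop
          exact this.eventually (eventually_ne_nhds hw2)
        filter_upwards [h1, h2] with q hq1 hq2 hq
        by_cases hq0 : q.1 = 0
        · rw [hq0] at hq
          exact hq2 (mem_flatten_zero.1 hq).2
        · exact smul_ne_zero hq0 hq2 (h.1 _ ((mem_flatten hq0).1 hq) hq1)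
  · have h1 : ContinuousAt (fun t : ℝ => comap (stretch 1 t) Γ) t :=
      continuousAt_comap_stretch continuousAt_const continuousAt_const continuousAt_id
        one_ne_zero ht
    refine h1.congr ?_
    filter_upwards [eventually_ne_nhds ht] with s hs
    rw [flatten, if_neg hs]

theorem joinedIn_flatten {Γ : ChabautySpace (V × W)} (hS : Γ ∈ straightSubgroups V W)
    (hD : Γ ∈ discreteSubgroups (V × W)) :
    JoinedIn (straightSubgroups V W ∩ discreteSubgroups (V × W)) Γ (flatten 0 Γ) := by
  refine JoinedIn.symm ⟨⟨⟨fun t : I => flatten (t : ℝ) Γ,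
    (continuous_flatten hS).comp continuous_subtype_val⟩, by simp, by simp [flatten_one]⟩,
    fun t => ⟨flatten_mem_straightSubgroups ?_ hS, flatten_mem_discreteSubgroups _ hD⟩⟩
  rw [abs_of_nonneg t.2.1]
  exact t.2.2

theorem joinedIn_straightening {Γ : ChabautySpace (V × W)} {τ : V →L[ℝ] W} (hτ : ‖τ‖ ≤ 1 / 8)
    (hS : comap (shear τ) Γ ∈ straightSubgroups V W) (hD : Γ ∈ discreteSubgroups (V × W)) :
    JoinedIn (nearAxis V W ∩ discreteSubgroups (V × W)) Γ (comap (shear τ) Γ) := by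
  refine ⟨⟨⟨fun t : I => comap (shear ((t : ℝ) • τ)) Γ,
    continuous_comap_shear continuous_const (by fun_prop)⟩, by simp [shear_zero], by simp⟩,
    -- The part of the shear not yet carried out straightens the subgroup at time t.
    fun t => ⟨⟨(1 - (t : ℝ)) • τ, ?_, ?_⟩, ?_⟩⟩
  · rw [norm_smul, Real.norm_of_nonneg (sub_nonneg.2 t.2.2)]
    nlinarith [t.2.1, t.2.2, norm_nonneg τ]
  · simp only [Path.coe_mk_mk, comap_comap, shear_comp, ← add_smul]
    simpa using hS
  · refine comap_mem_discreteSubgroups (fun v w h => ?_) hD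
    simp only [shear_apply, Prod.mk.injEq] at h
    obtain ⟨h1, h2⟩ := h
    rw [h1] at h2
    exact Prod.ext h1 (add_right_cancel h2)

end Flatten

/-! ### The two local properties in product coordinates -/

section Local

variable {p : ℕ} {W : Type*} [NormedAddCommGroup W] [NormedSpace ℝ W]

/-- The subgroup `sℤᵖ × Λ` of `ℝᵖ × W`, where `Λ` is the trace of `Γ` on `0 × W`; at `s = 0` the
subgroup `Γ`. -/
noncomputable def discretize (Γ : ChabautySpace ((Fin p → ℝ) × W)) (s : ℝ) :
    ChabautySpace ((Fin p → ℝ) × W) :=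
  if s = 0 then Γ else comap (stretch s⁻¹ 1) (intProd p (comap (.inr ℝ (Fin p → ℝ) W) Γ))

theorem mem_discretize {Γ : ChabautySpace ((Fin p → ℝ) × W)} {s : ℝ} (hs : s ≠ 0)
    {v : (Fin p → ℝ) × W} :
    v ∈ discretize Γ s ↔ (∀ i, s⁻¹ * v.1 i ∈ Set.range ((↑) : ℤ → ℝ)) ∧ (0, v.2) ∈ Γ := by
  rw [discretize, if_neg hs, mem_comap, mem_intProd]
  simp

variable [FiniteDimensional ℝ W]

/-- All discrete subgroups near the axis are joined to the single lattice ℤᵖ × 0 by straightening,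
flattening, and moving the resulting lattice through matrices. -/
theorem joinedIn_nearAxis_lattice {Γ : ChabautySpace ((Fin p → ℝ) × W)}
    (hN : Γ ∈ nearAxis (Fin p → ℝ) W) (hD : Γ ∈ discreteSubgroups ((Fin p → ℝ) × W)) :
    JoinedIn (nearAxis (Fin p → ℝ) W ∩ discreteSubgroups ((Fin p → ℝ) × W)) Γ (lattice W 1) := by
  obtain ⟨τ, hτ, hS⟩ := hN
  have h1 := joinedIn_straightening hτ hS hD
  have hD' := h1.target_mem.2
  have h2 := joinedIn_flatten hS hD'
  obtain ⟨M, hM, hML⟩ := exists_eq_lattice h2.target_mem.2 h2.target_mem.1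
    fun v hv => (mem_flatten_zero.1 hv).2
  have h3 := h2.target_mem.1
  rw [hML] at h2 h3
  exact h1.trans ((h2.trans (joinedIn_lattice_one hM h3)).mono
    (Set.inter_subset_inter_left _ straightSubgroups_subset_nearAxis))

theorem locallyTrivialAt_axis :
    LocallyTrivialAt (discreteSubgroups ((Fin p → ℝ) × W)) (axis (Fin p → ℝ) W) :=
  ⟨nearAxis _ _, nearAxis_mem_nhds, homotopicallyTrivialIn_nearAxis, fun _ hy _ hz =>
    (joinedIn_nearAxis_lattice hy.1 hy.2).trans (joinedIn_nearAxis_lattice hz.1 hz.2).symm⟩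

/-- The hypothesis says that Γ is ℝᵖ × Λ. Rounding the first component to sℤᵖ moves an element by at
most |s|, and for s ≠ 0 the discretized subgroup lies inside Γ. -/
theorem continuous_discretize {Γ : ChabautySpace ((Fin p → ℝ) × W)}
    (hΓ : ∀ v : (Fin p → ℝ) × W, v ∈ Γ ↔ (0, v.2) ∈ Γ) : Continuous (discretize Γ) := by
  rw [continuous_iff_continuousAt]
  intro s
  rcases eq_or_ne s 0 with rfl | hs
  · have h0 : discretize Γ 0 = Γ := if_pos rfl
    rw [continuousAt_iff, h0]
    refine ⟨fun v hv O hO => ?_, fun w hw => ?_⟩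
    · obtain ⟨ε, hε, hεO⟩ := Metric.mem_nhds_iff.1 hO
      have h1 : ∀ᶠ s : ℝ in 𝓝 0, |s| < ε :=
        (continuous_abs.tendsto (0 : ℝ)).eventually (by simpa using eventually_lt_nhds hε)
      filter_upwards [h1] with s hsε
      rcases eq_or_ne s 0 with rfl | hs
      · exact ⟨v, mem_of_mem_nhds hO, by rwa [h0]⟩
      set y : Fin p → ℝ := fun i => (⌊(s⁻¹ • v.1) i⌋ : ℝ) with hy
      refine ⟨(s • y, v.2), hεO ?_, ?_⟩
      · rw [mem_ball, Prod.dist_eq]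
        refine max_lt ?_ (by simpa using hε)
        have h2 : s • y - v.1 = s • (y - s⁻¹ • v.1) := by rw [smul_sub, smul_inv_smul₀ hs]
        change dist (s • y) v.1 < ε
        rw [dist_eq_norm, h2, norm_smul, Real.norm_eq_abs]
        exact (mul_le_of_le_one_right (abs_nonneg _) (norm_floor_sub_le _)).trans_lt hsε
      · rw [mem_discretize hs]
        exact ⟨fun i => ⟨_, by simp [hy, hs]; rfl⟩, (hΓ v).1 hv⟩
    · filter_upwards [continuousAt_snd.eventually (Γ.isClosed_coe.isOpen_compl.mem_nhds hw)]
        with q hq hqΓ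
      refine hq ?_
      rcases eq_or_ne q.1 0 with hq0 | hq0
      · rwa [hq0, h0] at hqΓ
      · exact (hΓ _).2 ((mem_discretize hq0).1 hqΓ).2
  · have h1 : ContinuousAt (fun s : ℝ => comap (stretch s⁻¹ 1)
        (intProd p (comap (.inr ℝ (Fin p → ℝ) W) Γ))) s :=
      continuousAt_comap_stretch continuousAt_const (continuousAt_inv₀ hs) continuousAt_const
        (inv_ne_zero hs) one_ne_zero
    refine h1.congr ?_
    filter_upwards [eventually_ne_nhds hs] with u hu
    rw [discretize, if_neg hu]

theorem discretize_mem_discreteSubgroups {Γ : ChabautySpace ((Fin p → ℝ) × W)}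
    (hΓ : ∀ v ∈ maxSubspace Γ, v.2 = 0) {s : ℝ} (hs : s ≠ 0) :
    discretize Γ s ∈ discreteSubgroups ((Fin p → ℝ) × W) := by
  rw [discretize, if_neg hs]
  refine comap_mem_discreteSubgroups (stretch_injective (inv_ne_zero hs) one_ne_zero)
    (intProd_mem_discreteSubgroups (mem_discreteSubgroups_of_maxSubspace_eq_bot ?_))
  rw [eq_bot_iff]
  intro w hw
  refine hΓ (0, w) fun t => ?_
  simpa using hw t

/-- When the largest subspace is exactly ℝᵖ × 0, the group is ℝᵖ × Λ and Λ contains no line, hence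
is discrete. Then s ↦ sℤᵖ × Λ is a short path into the discrete subgroups. -/
theorem accessibleFrom_of_maxSubspace {Γ : ChabautySpace ((Fin p → ℝ) × W)}
    (hΓ : ∀ v, v ∈ maxSubspace Γ ↔ v.2 = 0) :
    AccessibleFrom (discreteSubgroups ((Fin p → ℝ) × W)) Γ := by
  intro O hO hΓO
  have hsat (v : (Fin p → ℝ) × W) : v ∈ Γ ↔ (0, v.2) ∈ Γ := by
    have h1 : (v.1, (0 : W)) ∈ Γ := maxSubspace_subset ((hΓ _).2 rfl)
    rw [← add_mem_cancel_left h1 (y := (0, v.2))]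
    simp
  have hc := continuous_discretize hsat
  have h0 : discretize Γ 0 = Γ := if_pos rfl
  obtain ⟨ε, hε, hεO⟩ := Metric.mem_nhds_iff.1
    (hc.continuousAt.preimage_mem_nhds (hO.mem_nhds (by rwa [h0])))
  refine ⟨discretize Γ (ε / 2), discretize_mem_discreteSubgroups (fun v => (hΓ v).1)
    (half_pos hε).ne', ⟨⟨fun t : I => discretize Γ (t * (ε / 2)),
      hc.comp (by fun_prop)⟩, by simp [h0], by simp⟩, fun t => hεO ?_⟩
  rw [mem_ball_zero_iff, Real.norm_of_nonneg (mul_nonneg t.2.1 (half_pos hε).le)]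
  nlinarith [t.2.1, t.2.2]

end Local

/-! ### Reduction to product coordinates and conclusion -/

section Global

variable {E : Type*} [NormedAddCommGroup E] [NormedSpace ℝ E] [FiniteDimensional ℝ E]

theorem exists_equiv_prod (V : Submodule ℝ E) :
    ∃ (p : ℕ) (W : Submodule ℝ E) (e : E ≃L[ℝ] (Fin p → ℝ) × W), ∀ v, v ∈ V ↔ (e v).2 = 0 := by
  obtain ⟨W, hW⟩ := V.exists_isCompl
  let e₁ : V ≃ₗ[ℝ] Fin (Module.finrank ℝ V) → ℝ := (Module.finBasis ℝ V).equivFun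
  refine ⟨_, W, ((Submodule.prodEquivOfIsCompl V W hW).symm.trans
    (e₁.prodCongr (LinearEquiv.refl ℝ W))).toContinuousLinearEquiv, fun v => ?_⟩
  simp

theorem accessibleFrom_discreteSubgroups (Γ : ChabautySpace E) :
    AccessibleFrom (discreteSubgroups E) Γ := by
  obtain ⟨p, W, e, he⟩ := exists_equiv_prod (maxSubspace Γ)
  refine .of_homeomorph (congr e) (preimage_congr_discreteSubgroups e)
    (accessibleFrom_of_maxSubspace fun v => ?_)
  have h : v ∈ maxSubspace (congr e Γ) ↔ e.symm v ∈ maxSubspace Γ := by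
    simp [mem_maxSubspace]
  rw [h, he, e.apply_symm_apply]

/-- The same N is a neighbourhood of all points near x. This lets local triviality pass from a limit
subspace to the expansions converging to it. -/
theorem isOpen_setOf_locallyTrivialAt {X : Type*} [TopologicalSpace X] (D : Set X) :
    IsOpen {x | LocallyTrivialAt D x} := by
  refine isOpen_iff_mem_nhds.2 fun x ⟨N, hN, h⟩ => ?_
  filter_upwards [eventually_eventually_nhds.2 hN] with y hy
  exact ⟨N, hy, h⟩

theorem locallyTrivialAt_ofSubmodule (V : Submodule ℝ E) :
    LocallyTrivialAt (discreteSubgroups E) (ofSubmodule V) := by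
  obtain ⟨p, W, e, he⟩ := exists_equiv_prod V
  refine .of_homeomorph (congr e) (preimage_congr_discreteSubgroups e) ?_
  convert! locallyTrivialAt_axis (p := p) (W := W) using 1
  exact SetLike.ext fun v => by simp [he]

/-- Some expansion of Γ is so close to a linear subspace that local triviality holds there;
expansion is a homeomorphism preserving discreteness, so it holds at Γ. -/
theorem locallyTrivialAt_discreteSubgroups (Γ : ChabautySpace E) :
    LocallyTrivialAt (discreteSubgroups E) Γ := by
  obtain ⟨t, ht, ht0⟩ := (((tendsto_comap_smul Γ).eventually
    ((isOpen_setOf_locallyTrivialAt (discreteSubgroups E)).mem_nhds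
      (locallyTrivialAt_ofSubmodule _))).and self_mem_nhdsWithin).exists
  have ht0 : t ≠ 0 := (show 0 < t from ht0).ne'
  let e : E ≃L[ℝ] E := (LinearEquiv.smulOfNeZero ℝ E t ht0).symm.toContinuousLinearEquiv
  exact .of_homeomorph (congr e) (preimage_congr_discreteSubgroups e) ht

theorem simplyConnectedSpace : SimplyConnectedSpace (ChabautySpace E) :=
  simplyConnectedSpace_of_locallyTrivial (D := discreteSubgroups E)
    ⟨trivialSubgroup E, 1, one_pos, fun _ hv _ => hv⟩ homotopicallyTrivialIn_discreteSubgroups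
    (fun _ hx _ hy => (joined_trivialSubgroup hx).trans (joined_trivialSubgroup hy).symm)
    accessibleFrom_discreteSubgroups locallyTrivialAt_discreteSubgroups

end Global

end ChabautySpace

theorem theoremC (n : ℕ) :
    SimplyConnectedSpace (ChabautySpace (EuclideanSpace ℝ (Fin n))) := by
  exact ChabautySpace.simplyConnectedSpace
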